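/- For a Borel measure $\mu$ on $\mathbb{R}^2$ and $1\le p<\infty$, $x\in\mathbb{R}^2$, $r>0$, put $$\tilde\beta_{\mu,p}(x,r)=\inf_{L}\left(\frac{1}{\mu(B(x,r))}\int_{B(x,r)}\Big(\frac{\operatorname{dist}(y,L)}{r}\Big)^p\,d\mu(y)\right)^{1/p},$$ where the infimum is over all affine lines $L\subset\mathbb{R}^2$ and $B(x,r)$ is the closed ball (for $\mu(B(x,r))=0$ the value is taken to be $0$). Let $\mathcal{H}^1$ be the one-dimensional Hausdorff measure on $\mathbb{R}^2$. A set $F\subset\mathbb{R}^2$ is called $1$-rectifiable if there are Lipschitz maps $f_i:\mathbb{R}\to\mathbb{R}^2$, $i=1,2,\dots$, with $\mathcal{H}^1\big(F\setminus\bigcup_i f_i(\mathbb{R})\big)=0$, and $E\subset\mathbb{R}^2$ is called purely $1$-unrectifiable if $\mathcal{H}^1(F)=0$ for every $1$-rectifiable subset $F\subset E$. **Theorem 3.1.** There exists a Borel set $E\subset\mathbb{R}^2$ with $0<\mathcal{H}^1(E)<\infty$ which is purely $1$-unrectifiable and such that, for every $p$ with $1\le p<2$, $$\int_0^1\tilde\beta_{\mathcal{H}^1|_E,\,p}(x,r)^2\,\frac{dr}{r}<\infty\qquad\text{for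 }\mathcal{H}^1\text{-a.e. }x\in E .$$ -/

import Mathlib

open MeasureTheory Set
open scoped ENNReal

/-- A measure `μ` on `ℝᵈ` is `n`-rectifiable: `μ`-almost all of `ℝᵈ` is covered by countably many
Lipschitz images of `ℝⁿ`, and `μ` is absolutely continuous with respect to the `n`-dimensional
Hausdorff measure. -/
def IsRectifiableMeasure (n : ℕ) {d : ℕ} (μ : Measure (EuclideanSpace ℝ (Fin d))) : Prop :=
  (∃ f : ℕ → EuclideanSpace ℝ (Fin n) → EuclideanSpace ℝ (Fin d),
    (∀ i, ∃ K : NNReal, LipschitzWith K (f i)) ∧ μ (⋃ i, range (f i))ᶜ = 0) ∧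
  μ ≪ Measure.hausdorffMeasure (n : ℝ)

/-- A set `E ⊆ ℝᵈ` is `n`-rectifiable if `𝓗ⁿ` restricted to `E` is. -/
def IsRectifiableSet (n : ℕ) {d : ℕ} (E : Set (EuclideanSpace ℝ (Fin d))) : Prop :=
  IsRectifiableMeasure n ((Measure.hausdorffMeasure (n : ℝ)).restrict E)

/-- A set `E ⊆ ℝᵈ` is purely `n`-unrectifiable if its `n`-rectifiable subsets are `𝓗ⁿ`-null. -/
def IsPurelyUnrectifiable (n : ℕ) {d : ℕ} (E : Set (EuclideanSpace ℝ (Fin d))) : Prop :=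
  ∀ F ⊆ E, IsRectifiableSet n F → Measure.hausdorffMeasure (n : ℝ) F = 0

/-- `L` is an (affine) `n`-plane in `ℝᵈ`. -/
def IsAffinePlane (n : ℕ) {d : ℕ} (L : AffineSubspace ℝ (EuclideanSpace ℝ (Fin d))) : Prop :=
  (L : Set (EuclideanSpace ℝ (Fin d))).Nonempty ∧ Module.finrank ℝ L.direction = n

/-- The density-normalised coefficient
`inf_L (μ(B(x,r))⁻¹ ∫_{B(x,r)} (dist(y,L) / r)ᵖ dμ(y))^(1/p)`, where `L` runs over the `n`-planes
of `ℝᵈ`, with values in `[0, ∞]`. It is used for `p ≥ 1` and `r > 0`. -/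
noncomputable def betaTilde (n : ℕ) {d : ℕ} (p : ℝ) (μ : Measure (EuclideanSpace ℝ (Fin d)))
    (x : EuclideanSpace ℝ (Fin d)) (r : ℝ) : ℝ≥0∞ :=
  ⨅ (L : AffineSubspace ℝ (EuclideanSpace ℝ (Fin d))) (_ : IsAffinePlane n L),
    ((∫⁻ y in Metric.closedBall x r,
        (Metric.infEDist y (L : Set (EuclideanSpace ℝ (Fin d))) / ENNReal.ofReal r) ^ p ∂μ) /
      μ (Metric.closedBall x r)) ^ (1 / p)

/-! The set is the graph over `[0, 1)` of `tail 0`. In every interval of length `scale k`, an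
initial piece of proportion `freq k = 1 / (k + 10)` is lifted by `scale k`, and the scales decrease
so fast that later displacements are negligible.

Unrectifiability: since the sum of `freq k` diverges, almost every point is lifted infinitely often
(`ae_frequently_moved`). Around a point lifted in generation `k`, the ball of radius `scale k / 2`
meets only lifted points, whose measure is of order `freq k * scale k`. The lower density is
therefore zero almost everywhere (`ae_lower_density_graph`). A continuum has length at least `r` in
small balls of radius `r` about its points, so a set of lower density zero meets a rectifiable curve
in a null set (`isPurelyUnrectifiable_of_lower_density`).

Square function: write `a = freq (k + 1)` and `l = scale (k + 1)`, and let `r` lie between `l / 2`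
and `scale k / 2`. The visible graph is a horizontal piece together with a part raised by about `l`.
If the raised part has proportion about `a`, the squared coefficient is at most a constant times `a
^ (2 / p) * (l / r) ^ 2`, and the sum of `a ^ (2 / p)` converges exactly when `p < 2`. For a raised
centre and `r` comparable to `l`, the bound is only `a ^ (1 / p)`, apart from a window of radii
around `l` of relative width about `a`. Such centres have measure about `a`, so on average they cost
`a ^ (1 + 1 / p)`, which is summable (`lintegral_block_le`, `ae_tsum_blockBound_lt_top`). -/

namespace MovedGraph

/-! ### Scales, displacements and the height function -/

/-- The number of intervals of generation `k` in `[0, 1)`. -/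
def denom (k : ℕ) : ℕ := ∏ j ∈ Finset.range k, (j + 10) ^ 4

/-- The length of the intervals of generation `k`. -/
noncomputable def scale (k : ℕ) : ℝ := 1 / denom k

/-- The proportion of an interval of generation `k` that is moved upwards. -/
noncomputable def freq (k : ℕ) : ℝ := 1 / (k + 10)

/-- The part of the line that is moved upwards by `scale k`. -/
def moved (k : ℕ) : Set ℝ := {t | Int.fract (t * denom k) < freq k}

/-- The indicator function of `moved k`. -/
noncomputable def bit (k : ℕ) : ℝ → ℝ := (moved k).indicator 1

/-- The sum of all the displacements from generation `k` on. -/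
noncomputable def tail (k : ℕ) (t : ℝ) : ℝ := ∑' j, bit (k + j) t * scale (k + j)

lemma denom_succ (k : ℕ) : denom (k + 1) = denom k * (k + 10) ^ 4 := Finset.prod_range_succ _ _

lemma denom_pos (k : ℕ) : 0 < denom k := Finset.prod_pos fun j _ => by positivity

lemma denom_pos' (k : ℕ) : (0 : ℝ) < denom k := by exact_mod_cast denom_pos k

lemma scale_pos (k : ℕ) : 0 < scale k := one_div_pos.2 (denom_pos' k)

lemma scale_zero : scale 0 = 1 := by simp [scale, denom]

lemma freq_pos (k : ℕ) : 0 < freq k := by unfold freq; positivity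

lemma freq_le (k : ℕ) : freq k ≤ 1 / 10 := by
  unfold freq
  apply one_div_le_one_div_of_le (by norm_num)
  linarith [(Nat.cast_nonneg k : (0 : ℝ) ≤ k)]

lemma scale_succ (k : ℕ) : scale (k + 1) = scale k * freq k ^ 4 := by
  unfold scale freq
  rw [denom_succ]
  push_cast
  have := denom_pos' k
  field_simp

lemma freq_pow_le (k : ℕ) : freq k ^ 4 ≤ 1 / 10000 := by
  calc freq k ^ 4 ≤ (1 / 10) ^ 4 := pow_le_pow_left₀ (freq_pos k).le (freq_le k) 4
    _ = _ := by norm_num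

lemma scale_succ_le (k : ℕ) : scale (k + 1) ≤ scale k / 10000 := by
  rw [scale_succ]
  nlinarith [scale_pos k, freq_pow_le k]

lemma scale_add_le (k j : ℕ) : scale (k + j) ≤ scale k * (1 / 2) ^ j := by
  induction j with
  | zero => simp
  | succ j ih =>
    have := scale_succ_le (k + j)
    have h := scale_pos (k + j)
    rw [← add_assoc, pow_succ]
    linarith

lemma scale_antitone : Antitone scale :=
  antitone_nat_of_succ_le fun k => by linarith [scale_succ_le k, scale_pos k]

lemma scale_le_one (k : ℕ) : scale k ≤ 1 := scale_zero ▸ scale_antitone (Nat.zero_le k)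

lemma tendsto_scale : Filter.Tendsto scale Filter.atTop (nhds 0) := by
  refine squeeze_zero (fun k => (scale_pos k).le) (fun k => ?_)
    (tendsto_pow_atTop_nhds_zero_of_lt_one (r := (1 / 2 : ℝ)) (by norm_num) (by norm_num))
  simpa [scale_zero] using scale_add_le 0 k

lemma bit_of_mem {k : ℕ} {t : ℝ} (h : t ∈ moved k) : bit k t = 1 := by simp [bit, h]

lemma bit_of_notMem {k : ℕ} {t : ℝ} (h : t ∉ moved k) : bit k t = 0 := by simp [bit, h]

lemma bit_nonneg (k : ℕ) (t : ℝ) : 0 ≤ bit k t := indicator_nonneg (fun _ _ => zero_le_one) t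

lemma bit_le_one (k : ℕ) (t : ℝ) : bit k t ≤ 1 := indicator_le_self' (fun _ _ => zero_le_one) t

lemma bit_eq_iff {k : ℕ} {s t : ℝ} : bit k s = bit k t ↔ (s ∈ moved k ↔ t ∈ moved k) := by
  by_cases hs : s ∈ moved k <;> by_cases ht : t ∈ moved k <;>
    simp [bit, hs, ht]

lemma measurableSet_moved (k : ℕ) : MeasurableSet (moved k) :=
  measurableSet_lt (measurable_fract.comp (measurable_id.mul_const _)) measurable_const

lemma measurable_bit (k : ℕ) : Measurable (bit k) :=
  measurable_one.indicator (measurableSet_moved k)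

lemma summable_scale (k : ℕ) : Summable fun j => scale (k + j) :=
  Summable.of_nonneg_of_le (fun _ => (scale_pos _).le) (scale_add_le k)
    (summable_geometric_two.mul_left _)

lemma summable_bit (k : ℕ) (t : ℝ) : Summable fun j => bit (k + j) t * scale (k + j) :=
  Summable.of_nonneg_of_le (fun _ => mul_nonneg (bit_nonneg _ _) (scale_pos _).le)
    (fun _ => mul_le_of_le_one_left (scale_pos _).le (bit_le_one _ _)) (summable_scale k)

lemma tail_nonneg (k : ℕ) (t : ℝ) : 0 ≤ tail k t :=
  tsum_nonneg fun _ => mul_nonneg (bit_nonneg _ _) (scale_pos _).le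

lemma tail_le (k : ℕ) (t : ℝ) : tail k t ≤ 2 * scale k := by
  have h : ∀ j, bit (k + j) t * scale (k + j) ≤ scale k * (1 / 2) ^ j := fun j =>
    (mul_le_of_le_one_left (scale_pos _).le (bit_le_one _ _)).trans (scale_add_le k j)
  calc tail k t ≤ ∑' j : ℕ, scale k * (1 / 2) ^ j :=
        (summable_bit k t).tsum_le_tsum h (summable_geometric_two.mul_left _)
    _ = 2 * scale k := by rw [tsum_mul_left, tsum_geometric_two]; ring

lemma tail_eq (k : ℕ) (t : ℝ) : tail k t = bit k t * scale k + tail (k + 1) t := by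
  unfold tail
  rw [(summable_bit k t).tsum_eq_zero_add]
  simp only [add_zero]
  congr 1
  exact tsum_congr fun j => by rw [show k + (j + 1) = k + 1 + j by ring]

lemma measurable_tail (k : ℕ) : Measurable (tail k) :=
  Measurable.tsum fun _ => (measurable_bit _).mul_const _

/-- The height of the graph, without the displacements from generation `k` on. -/
noncomputable def head (k : ℕ) (t : ℝ) : ℝ := ∑ j ∈ Finset.range k, bit j t * scale j

lemma head_add_tail (k : ℕ) (t : ℝ) : head k t + tail k t = tail 0 t := by
  induction k with
  | zero => simp [head]
  | succ k ih =>
    rw [← ih, tail_eq k, head, Finset.sum_range_succ, head]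
    ring

lemma head_congr {k : ℕ} {s t : ℝ} (h : ∀ j < k, bit j s = bit j t) : head k s = head k t :=
  Finset.sum_congr rfl fun j hj => by rw [h j (Finset.mem_range.1 hj)]

lemma tail_zero_sub {k : ℕ} {s t : ℝ} (h : ∀ j < k, bit j s = bit j t) :
    tail 0 s - tail 0 t = tail k s - tail k t := by
  rw [← head_add_tail k s, ← head_add_tail k t, head_congr h]
  ring

lemma abs_tail_zero_sub_le {k : ℕ} {s t : ℝ} (h : ∀ j < k, bit j s = bit j t) :
    |tail 0 s - tail 0 t| ≤ 2 * scale k := by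
  rw [tail_zero_sub h, abs_le]
  constructor <;> linarith [tail_nonneg k s, tail_nonneg k t, tail_le k s, tail_le k t]

/-- The first generation in which two points differ decides their height difference: it contributes
`scale k`, and everything later can cancel at most `2 * scale (k + 1)`. -/
lemma le_abs_tail_zero_sub {k : ℕ} {s t : ℝ} (h : ∀ j < k, bit j s = bit j t)
    (hk : bit k s ≠ bit k t) : scale k - 2 * scale (k + 1) ≤ |tail 0 s - tail 0 t| := by
  rw [tail_zero_sub h, tail_eq k s, tail_eq k t]
  have h1 := tail_nonneg (k + 1) s
  have h2 := tail_nonneg (k + 1) t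
  have h3 := tail_le (k + 1) s
  have h4 := tail_le (k + 1) t
  rw [le_abs]
  by_cases hs : s ∈ moved k <;> by_cases ht : t ∈ moved k
  · exact absurd (by rw [bit_of_mem hs, bit_of_mem ht]) hk
  · left; rw [bit_of_mem hs, bit_of_notMem ht]; linarith
  · right; rw [bit_of_notMem hs, bit_of_mem ht]; linarith
  · exact absurd (by rw [bit_of_notMem hs, bit_of_notMem ht]) hk

/-- Points of the graph whose heights are close were moved in the same generations. -/
lemma bit_eq_of_abs_sub_le {k : ℕ} {s t : ℝ} (h : |tail 0 s - tail 0 t| ≤ scale k / 2) :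
    ∀ j ≤ k, bit j s = bit j t := by
  intro j
  induction j using Nat.strong_induction_on with
  | _ j ih =>
    intro hj
    by_contra hne
    have h1 := le_abs_tail_zero_sub (fun i hi => ih i hi (hi.le.trans hj)) hne
    have h2 := scale_antitone hj
    have h3 := scale_succ_le j
    have h4 := scale_pos j
    linarith

/-! ### The nested intervals of the construction -/

lemma floor_denom (k : ℕ) (t : ℝ) :
    ⌊t * denom k⌋ = ⌊t * denom (k + 1)⌋ / (((k + 10) ^ 4 : ℕ) : ℤ) := by
  rw [← Int.floor_div_natCast, denom_succ]
  congr 1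
  push_cast
  have : ((k : ℝ) + 10) ≠ 0 := by positivity
  field_simp

lemma mem_moved_iff_lt {k : ℕ} {t : ℝ} :
    t ∈ moved k ↔ t * denom k < ⌊t * denom k⌋ + freq k := by
  simp only [moved, mem_ofPred_eq, Int.fract]
  constructor <;> intro h <;> linarith

/-- Because `freq k * (k + 10) ^ 4 = (k + 10) ^ 3` is an integer, `moved k` is a union of intervals
of generation `k + 1`. Hence all bits below `k` are constant on an interval of generation `k`. -/
lemma mem_moved_iff_floor {k : ℕ} {t : ℝ} : t ∈ moved k ↔
    ⌊t * denom (k + 1)⌋ < (k + 10) ^ 4 * ⌊t * denom k⌋ + (k + 10) ^ 3 := by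
  rw [mem_moved_iff_lt, Int.floor_lt, denom_succ, freq]
  push_cast
  have h : (0 : ℝ) < (k : ℝ) + 10 := by positivity
  have e : ((k : ℝ) + 10) ^ 4 * (⌊t * denom k⌋ + 1 / ((k : ℝ) + 10))
      = ((k : ℝ) + 10) ^ 4 * ⌊t * denom k⌋ + ((k : ℝ) + 10) ^ 3 := by
    field_simp
  rw [← e, ← mul_lt_mul_iff_right₀ (pow_pos h 4)]
  ring_nf

lemma floor_eq_of_le {j k : ℕ} (hjk : j ≤ k) {s t : ℝ} (h : ⌊s * denom k⌋ = ⌊t * denom k⌋) :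
    ⌊s * denom j⌋ = ⌊t * denom j⌋ := by
  induction k, hjk using Nat.le_induction with
  | base => exact h
  | succ k _ ih => exact ih (by rw [floor_denom, h, ← floor_denom])

lemma bit_eq_of_floor_eq {j k : ℕ} (hjk : j < k) {s t : ℝ}
    (h : ⌊s * denom k⌋ = ⌊t * denom k⌋) : bit j s = bit j t := by
  rw [bit_eq_iff, mem_moved_iff_floor, mem_moved_iff_floor, floor_eq_of_le hjk h,
    floor_eq_of_le hjk.le h]

lemma mem_Ico_iff_floor {k : ℕ} {n : ℤ} {t : ℝ} :
    t ∈ Ico (n * scale k) ((n + 1) * scale k) ↔ ⌊t * denom k⌋ = n := by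
  rw [Int.floor_eq_iff, mem_Ico, scale, mul_one_div, mul_one_div, div_le_iff₀ (denom_pos' k),
    lt_div_iff₀ (denom_pos' k)]

lemma Ico_subset_unit {k : ℕ} {t : ℝ} (ht : t ∈ Ico (0 : ℝ) 1) :
    Ico (⌊t * denom k⌋ * scale k) ((⌊t * denom k⌋ + 1) * scale k) ⊆ Ico 0 1 := by
  have hd := denom_pos' k
  have h0 : 0 ≤ ⌊t * denom k⌋ := Int.floor_nonneg.2 (mul_nonneg ht.1 hd.le)
  have h1 : ⌊t * denom k⌋ < denom k := by
    rw [Int.floor_lt]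
    push_cast
    nlinarith [ht.2]
  have h2 : (⌊t * denom k⌋ : ℝ) + 1 ≤ denom k := by exact_mod_cast h1
  apply Ico_subset_Ico
  · exact mul_nonneg (by exact_mod_cast h0) (scale_pos k).le
  · calc _ ≤ (denom k : ℝ) * scale k := by gcongr; exact (scale_pos k).le
      _ = 1 := by unfold scale; field_simp

lemma mem_moved_iff_lt_scale {k : ℕ} {n : ℤ} {t : ℝ} (h : ⌊t * denom k⌋ = n) :
    t ∈ moved k ↔ t < (n + freq k) * scale k := by
  rw [mem_moved_iff_lt, h, scale, mul_one_div, lt_div_iff₀ (denom_pos' k)]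

/-- Around each point there is an interval on which the displacements of the generations up to `k`
are constant. -/
lemma exists_Ico {k : ℕ} {t : ℝ} (ht : t ∈ Ico (0 : ℝ) 1) : ∃ u v : ℝ, t ∈ Ico u v ∧
    Ico u v ⊆ Ico 0 1 ∧ freq k * scale k ≤ v - u ∧ (t ∉ moved k → scale k / 2 ≤ v - u) ∧
    ∀ s ∈ Ico u v, ∀ j < k + 1, bit j s = bit j t := by
  set n := ⌊t * denom k⌋ with hn
  have htn := mem_Ico_iff_floor.2 hn.symm
  have hl := scale_pos k
  have ha := freq_pos k
  have ha' := freq_le k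
  have hprev : ∀ s ∈ Ico (n * scale k) ((n + 1) * scale k), ∀ j < k, bit j s = bit j t :=
    fun s hs j hj => bit_eq_of_floor_eq hj (by rw [mem_Ico_iff_floor.1 hs])
  by_cases hm : t ∈ moved k
  · have hsub : Ico (n * scale k) ((n + freq k) * scale k) ⊆
        Ico (n * scale k) ((n + 1) * scale k) := Ico_subset_Ico_right (by gcongr; linarith)
    refine ⟨n * scale k, (n + freq k) * scale k, ⟨htn.1, (mem_moved_iff_lt_scale hn.symm).1 hm⟩,
      hsub.trans (Ico_subset_unit ht), by linarith, fun h => absurd hm h, fun s hs j hj => ?_⟩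
    rcases (Nat.lt_succ_iff_lt_or_eq).1 hj with hj | rfl
    · exact hprev s (hsub hs) j hj
    · exact bit_eq_iff.2 (iff_of_true ((mem_moved_iff_lt_scale
        (mem_Ico_iff_floor.1 (hsub hs))).2 hs.2) hm)
  · have hsub : Ico ((n + freq k) * scale k) ((n + 1) * scale k) ⊆
        Ico (n * scale k) ((n + 1) * scale k) := Ico_subset_Ico_left (by gcongr; linarith)
    refine ⟨(n + freq k) * scale k, (n + 1) * scale k,
      ⟨not_lt.1 fun h => hm ((mem_moved_iff_lt_scale hn.symm).2 h), htn.2⟩,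
      hsub.trans (Ico_subset_unit ht), by nlinarith, fun _ => by nlinarith, fun s hs j hj => ?_⟩
    rcases (Nat.lt_succ_iff_lt_or_eq).1 hj with hj | rfl
    · exact hprev s (hsub hs) j hj
    · exact bit_eq_iff.2 (iff_of_false (fun h => hs.1.not_gt ((mem_moved_iff_lt_scale
        (mem_Ico_iff_floor.1 (hsub hs))).1 h)) hm)

lemma card_floor_le {k : ℕ} {a b : ℝ} (hab : a ≤ b) :
    ((Finset.Icc ⌊a * denom k⌋ ⌊b * denom k⌋).card : ℝ) * scale k ≤ b - a + 2 * scale k := by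
  have hd := denom_pos' k
  have h0 : ⌊a * denom k⌋ ≤ ⌊b * denom k⌋ := Int.floor_le_floor (by gcongr)
  have h1 : ((Finset.Icc ⌊a * denom k⌋ ⌊b * denom k⌋).card : ℝ)
      = ⌊b * denom k⌋ + 1 - ⌊a * denom k⌋ := by
    rw [Int.card_Icc, ← Int.cast_natCast, Int.toNat_of_nonneg (by omega)]
    push_cast
    ring
  have h2 := Int.floor_le (b * denom k)
  have h3 := Int.sub_one_lt_floor (a * denom k)
  rw [h1, scale]
  calc ((⌊b * denom k⌋ : ℝ) + 1 - ⌊a * denom k⌋) * (1 / denom k)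
      ≤ ((b - a) * denom k + 2) * (1 / denom k) := by gcongr; linarith
    _ = _ := by field_simp

/-- The moved part has small proportion in each interval that is not too short. -/
lemma volume_inter_moved_le (k : ℕ) (t : ℝ) {r : ℝ} (hr : 0 ≤ r) :
    volume (Icc (t - r) (t + r) ∩ moved k)
      ≤ ENNReal.ofReal (freq k * (2 * r + 2 * scale k)) := by
  have hl := scale_pos k
  have ha := freq_pos k
  have hsub : Icc (t - r) (t + r) ∩ moved k ⊆
      ⋃ n ∈ Finset.Icc ⌊(t - r) * denom k⌋ ⌊(t + r) * denom k⌋,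
        Ico (n * scale k) ((n + freq k) * scale k) := by
    rintro s ⟨hs, hm⟩
    have hd := denom_pos' k
    simp only [mem_iUnion]
    exact ⟨⌊s * denom k⌋, Finset.mem_Icc.2 ⟨Int.floor_le_floor (by gcongr; exact hs.1),
      Int.floor_le_floor (by gcongr; exact hs.2)⟩, (mem_Ico_iff_floor.2 rfl).1,
      (mem_moved_iff_lt_scale rfl).1 hm⟩
  refine (measure_mono hsub).trans ((measure_biUnion_finset_le _ _).trans ?_)
  simp only [Real.volume_Ico]
  rw [Finset.sum_congr rfl (g := fun _ => ENNReal.ofReal (freq k * scale k))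
    (fun n _ => by congr 1; ring), Finset.sum_const, nsmul_eq_mul, ← ENNReal.ofReal_natCast,
    ← ENNReal.ofReal_mul (by positivity)]
  apply ENNReal.ofReal_le_ofReal
  have := card_floor_le (k := k) (show t - r ≤ t + r by linarith)
  nlinarith

/-! ### Almost every point is moved infinitely often -/

/-- The fraction of `[0, 1)` that is not moved in any of the generations from `K` to `n`. -/
lemma exists_cover_not_moved (K n : ℕ) (hn : K ≤ n) : ∃ F : Finset ℤ,
    {t ∈ Ico (0 : ℝ) 1 | ∀ j, K ≤ j → j < n → t ∉ moved j} ⊆ {t | ⌊t * denom n⌋ ∈ F} ∧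
    (F.card : ℝ) * (n + 9) ≤ denom n * (K + 9) := by
  induction n, hn using Nat.le_induction with
  | base =>
    refine ⟨Finset.Ico 0 (denom K), fun t ht => ?_, by simp⟩
    have hd := denom_pos' K
    simp only [mem_ofPred_eq, Finset.mem_Ico, Int.floor_nonneg, Int.floor_lt]
    refine ⟨mul_nonneg ht.1.1 hd.le, ?_⟩
    push_cast
    nlinarith [ht.1.2]
  | succ n hn ih =>
    obtain ⟨F, hF, hc⟩ := ih
    refine ⟨(F ×ˢ Finset.Ico (((n + 10) ^ 3 : ℕ) : ℤ) (((n + 10) ^ 4 : ℕ) : ℤ)).image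
      (fun x => ((n : ℤ) + 10) ^ 4 * x.1 + x.2), fun t ht => ?_, ?_⟩
    · simp only [mem_ofPred_eq, Finset.mem_image, Finset.mem_product, Prod.exists, Finset.mem_Ico]
      have h1 := hF ⟨ht.1, fun j h1 h2 => ht.2 j h1 (by omega)⟩
      have h2 := ht.2 n hn (by omega)
      rw [mem_moved_iff_floor, not_lt] at h2
      have h3 := floor_denom n t
      have hM : (0 : ℤ) < (((n + 10) ^ 4 : ℕ) : ℤ) := by positivity
      have h4 := Int.lt_ediv_add_one_mul_self ⌊t * denom (n + 1)⌋ hM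
      rw [← h3] at h4
      refine ⟨⌊t * denom n⌋, ⌊t * denom (n + 1)⌋ - (n + 10) ^ 4 * ⌊t * denom n⌋,
        ⟨h1, ?_, ?_⟩, by ring⟩
      · push_cast; linarith
      · push_cast at h4 ⊢; linarith
    · have h1 : ((((F ×ˢ Finset.Ico (((n + 10) ^ 3 : ℕ) : ℤ) (((n + 10) ^ 4 : ℕ) : ℤ)).image
          (fun x => ((n : ℤ) + 10) ^ 4 * x.1 + x.2)).card : ℕ) : ℝ)
          ≤ F.card * ((n + 10) ^ 4 - (n + 10) ^ 3) := by
        refine (Nat.cast_le.2 Finset.card_image_le).trans ?_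
        rw [Finset.card_product, Int.card_Ico, ← Nat.cast_sub (Nat.pow_le_pow_right (by omega)
          (by norm_num)), Int.toNat_natCast, Nat.cast_mul, Nat.cast_sub (Nat.pow_le_pow_right
          (by omega) (by norm_num))]
        push_cast
        exact le_rfl
      push_cast at h1
      rw [denom_succ]
      push_cast
      -- The surviving proportion in generation `n` is `1 - freq n = (n + 9) / (n + 10)`, so the
      -- product over generations telescopes to `(K + 9) / (n + 9)`.
      calc _ ≤ (F.card * (((n : ℝ) + 10) ^ 4 - (n + 10) ^ 3)) * ((n : ℝ) + 1 + 9) := by gcongr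
        _ = (F.card * ((n : ℝ) + 9)) * (n + 10) ^ 4 := by ring
        _ ≤ (denom n * ((K : ℝ) + 9)) * (n + 10) ^ 4 := by gcongr
        _ = _ := by ring

lemma volume_not_moved_le (K n : ℕ) (hn : K ≤ n) :
    volume {t ∈ Ico (0 : ℝ) 1 | ∀ j, K ≤ j → j < n → t ∉ moved j}
      ≤ ENNReal.ofReal ((K + 9) / (n + 9)) := by
  obtain ⟨F, hF, hc⟩ := exists_cover_not_moved K n hn
  have hsub : {t : ℝ | ⌊t * denom n⌋ ∈ F} ⊆
      ⋃ i ∈ F, Ico (i * scale n) ((i + 1) * scale n) := fun t ht => by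
    simp only [mem_iUnion]
    exact ⟨_, ht, mem_Ico_iff_floor.2 rfl⟩
  refine (measure_mono (hF.trans hsub)).trans ((measure_biUnion_finset_le _ _).trans ?_)
  simp only [Real.volume_Ico]
  rw [Finset.sum_congr rfl (g := fun _ => ENNReal.ofReal (scale n))
    (fun n _ => by congr 1; ring), Finset.sum_const, nsmul_eq_mul, ← ENNReal.ofReal_natCast,
    ← ENNReal.ofReal_mul (by positivity)]
  apply ENNReal.ofReal_le_ofReal
  have := denom_pos' n
  rw [scale, mul_one_div, div_le_div_iff₀ this (by positivity)]
  linarith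

/-- Almost every point is moved infinitely often. -/
lemma ae_frequently_moved :
    ∀ᵐ t ∂(volume.restrict (Ico (0 : ℝ) 1)), ∀ K, ∃ j, K ≤ j ∧ t ∈ moved j := by
  rw [ae_all_iff]
  intro K
  rw [ae_restrict_iff' measurableSet_Ico, ae_iff]
  have hlim : Filter.Tendsto (fun n : ℕ => ENNReal.ofReal ((K + 9) / ((n : ℝ) + 9)))
      Filter.atTop (nhds 0) := by
    rw [← ENNReal.ofReal_zero]
    exact ENNReal.tendsto_ofReal (Filter.Tendsto.const_div_atTop
      (Filter.tendsto_atTop_add_const_right _ _ tendsto_natCast_atTop_atTop) _)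
  refine le_antisymm (ge_of_tendsto hlim ?_) (zero_le)
  filter_upwards [Filter.eventually_ge_atTop K] with n hn
  refine (measure_mono fun t ht => ?_).trans (volume_not_moved_le K n hn)
  simp only [mem_ofPred_eq, Classical.not_imp, not_exists, not_and] at ht
  exact ⟨ht.1, fun j h1 _ => ht.2 j h1⟩

/-! ### The graph and its Hausdorff measure -/

/-- The point of the graph over `t`. -/
noncomputable def curve (t : ℝ) : EuclideanSpace ℝ (Fin 2) := !₂[t, tail 0 t]

/-- The graph of the sum of all displacements, over `[0, 1)`. -/
def graph : Set (EuclideanSpace ℝ (Fin 2)) := curve '' Ico 0 1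

@[simp] lemma curve_zero (t : ℝ) : curve t 0 = t := rfl

@[simp] lemma curve_one (t : ℝ) : curve t 1 = tail 0 t := rfl

lemma dist_curve (s t : ℝ) :
    dist (curve s) (curve t) = √((s - t) ^ 2 + (tail 0 s - tail 0 t) ^ 2) := by
  simp [EuclideanSpace.dist_eq, Fin.sum_univ_two, Real.dist_eq, sq_abs]

lemma curve_injective : Function.Injective curve := fun s t h => by
  simpa using congrArg (fun x : EuclideanSpace ℝ (Fin 2) => x 0) h

lemma measurable_curve : Measurable curve := by
  have h : Measurable fun t : ℝ => (![t, tail 0 t] : Fin 2 → ℝ) := by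
    rw [measurable_pi_iff]
    intro i
    fin_cases i
    · exact measurable_id
    · exact measurable_tail 0
  exact (PiLp.continuous_toLp 2 _).measurable.comp h

lemma measurableSet_graph : MeasurableSet graph :=
  measurableSet_Ico.image_of_measurable_injOn measurable_curve curve_injective.injOn

lemma lipschitz_coord : LipschitzWith 1 fun x : EuclideanSpace ℝ (Fin 2) => x 0 :=
  LipschitzWith.of_dist_le_mul fun x y => by
    rw [NNReal.coe_one, one_mul, EuclideanSpace.dist_eq, Fin.sum_univ_two]
    exact Real.le_sqrt_of_sq_le (by linarith [sq_nonneg (dist (x 1) (y 1))])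

lemma volume_le_hausdorffMeasure (T : Set ℝ) :
    volume T ≤ Measure.hausdorffMeasure 1 (curve '' T) := by
  have h := lipschitz_coord.hausdorffMeasure_image_le zero_le_one (curve '' T)
  rw [image_image, hausdorffMeasure_real] at h
  simpa using h

lemma ediam_curve_le (k : ℕ) (n : ℤ) :
    Metric.ediam (curve '' Ico (n * scale k) ((n + 1) * scale k))
      ≤ ENNReal.ofReal (3 * scale k) := by
  have hl := scale_pos k
  apply Metric.ediam_le
  rintro _ ⟨s, hs, rfl⟩ _ ⟨t, ht, rfl⟩
  rw [edist_dist, dist_curve]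
  apply ENNReal.ofReal_le_ofReal
  have h1 : |tail 0 s - tail 0 t| ≤ 2 * scale k := abs_tail_zero_sub_le fun j hj =>
    bit_eq_of_floor_eq hj (by rw [mem_Ico_iff_floor.1 hs, mem_Ico_iff_floor.1 ht])
  have h2 : |s - t| ≤ scale k := by
    rw [abs_le]
    constructor <;> linarith [hs.1, hs.2, ht.1, ht.2]
  rw [Real.sqrt_le_left (by positivity), ← sq_abs (s - t), ← sq_abs (tail 0 s - tail 0 t)]
  nlinarith [abs_nonneg (s - t), abs_nonneg (tail 0 s - tail 0 t)]

/-- The pieces of the graph over generation-`k` intervals have diameter at most `3 * scale k`, and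
about `(b - a) / scale k` of them suffice. -/
lemma hausdorffMeasure_curve_Icc_le {a b : ℝ} (hab : a ≤ b) :
    Measure.hausdorffMeasure 1 (curve '' Icc a b) ≤ ENNReal.ofReal (3 * (b - a)) := by
  let ι : ℕ → Type := fun k => ↥(Finset.Icc ⌊a * denom k⌋ ⌊b * denom k⌋)
  have hr : Filter.Tendsto (fun k => ENNReal.ofReal (3 * scale k)) Filter.atTop (nhds 0) := by
    rw [← ENNReal.ofReal_zero, ← mul_zero 3]
    exact ENNReal.tendsto_ofReal (tendsto_scale.const_mul 3)
  have h := Measure.hausdorffMeasure_le_liminf_sum (ι := ι) 1 (curve '' Icc a b) _ hr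
    (fun k n => curve '' Ico ((n : ℤ) * scale k) (((n : ℤ) + 1) * scale k))
    (Filter.Eventually.of_forall fun k n => ediam_curve_le k n)
    (Filter.Eventually.of_forall fun k => by
      rintro _ ⟨t, ht, rfl⟩
      have hd := denom_pos' k
      exact mem_iUnion.2 ⟨⟨⌊t * denom k⌋, Finset.mem_Icc.2 ⟨Int.floor_le_floor
        (by gcongr; exact ht.1), Int.floor_le_floor (by gcongr; exact ht.2)⟩⟩,
        mem_image_of_mem _ (mem_Ico_iff_floor.2 rfl)⟩)
  have hlim : Filter.Tendsto (fun k => ENNReal.ofReal (3 * (b - a + 2 * scale k)))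
      Filter.atTop (nhds (ENNReal.ofReal (3 * (b - a)))) := by
    refine ENNReal.tendsto_ofReal ?_
    simpa using ((tendsto_scale.const_mul 2).const_add (b - a)).const_mul 3
  refine h.trans ((Filter.liminf_le_liminf (Filter.Eventually.of_forall fun k => ?_)).trans
    hlim.liminf_eq.le)
  calc _ ≤ ∑ n : ι k, ENNReal.ofReal (3 * scale k) := Finset.sum_le_sum fun n _ => by
        rw [ENNReal.rpow_one]
        exact ediam_curve_le k n
    _ = ENNReal.ofReal (3 * ((Finset.Icc ⌊a * denom k⌋ ⌊b * denom k⌋).card * scale k)) := by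
        rw [Finset.sum_const, Finset.card_univ, Fintype.card_coe, nsmul_eq_mul,
          ← ENNReal.ofReal_natCast, ← ENNReal.ofReal_mul (Nat.cast_nonneg _)]
        congr 1
        ring
    _ ≤ _ := by
        gcongr
        exact card_floor_le hab

lemma coord_preimage_inter_graph (T : Set ℝ) :
    (fun x : EuclideanSpace ℝ (Fin 2) => x 0) ⁻¹' T ∩ graph = curve '' (T ∩ Ico 0 1) := by
  ext x
  constructor
  · rintro ⟨h, t, ht, rfl⟩
    exact ⟨t, ⟨h, ht⟩, rfl⟩
  · rintro ⟨t, ht, rfl⟩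
    exact ⟨ht.1, t, ht.2, rfl⟩

/-- Extends the estimate from intervals to all measurable sets: `𝓗¹` on the line dominates every
measure that is bounded by the diameter on each set. -/
lemma map_coord_le : (3 : ℝ≥0∞)⁻¹ • ((Measure.hausdorffMeasure 1).restrict graph).map
    (fun x : EuclideanSpace ℝ (Fin 2) => x 0) ≤ volume := by
  rw [← hausdorffMeasure_real]
  refine Measure.le_hausdorffMeasure 1 _ ⊤ ENNReal.zero_lt_top fun s _ => ?_
  rw [ENNReal.rpow_one]
  by_cases hs : Metric.ediam s = ⊤
  · rw [hs]
    exact le_top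
  have hb : Bornology.IsBounded s := Metric.isBounded_iff_ediam_ne_top.2 hs
  rcases s.eq_empty_or_nonempty with rfl | hne
  · simp
  have hab : sInf s ≤ sSup s := Real.sInf_le_sSup s hb.bddBelow hb.bddAbove
  have hsub : s ⊆ Icc (sInf s) (sSup s) := hb.subset_Icc_sInf_sSup
  refine (measure_mono hsub).trans ?_
  rw [Measure.smul_apply, Measure.map_apply lipschitz_coord.continuous.measurable measurableSet_Icc,
    Measure.restrict_apply (lipschitz_coord.continuous.measurable measurableSet_Icc),
    coord_preimage_inter_graph, Real.ediam_eq hb, smul_eq_mul]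
  calc _ ≤ (3 : ℝ≥0∞)⁻¹ * ENNReal.ofReal (3 * (sSup s - sInf s)) := by
        gcongr
        exact (measure_mono (image_mono inter_subset_left)).trans
          (hausdorffMeasure_curve_Icc_le hab)
    _ = _ := by
        rw [ENNReal.ofReal_mul (by norm_num), ENNReal.ofReal_ofNat, ← mul_assoc,
          ENNReal.inv_mul_cancel (by norm_num) (by norm_num), one_mul]

lemma hausdorffMeasure_curve_le {T : Set ℝ} (hT : MeasurableSet T) :
    Measure.hausdorffMeasure 1 (curve '' (T ∩ Ico 0 1)) ≤ 3 * volume T := by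
  have h := map_coord_le T
  rw [Measure.smul_apply, Measure.map_apply lipschitz_coord.continuous.measurable hT,
    Measure.restrict_apply (lipschitz_coord.continuous.measurable hT),
    coord_preimage_inter_graph, smul_eq_mul] at h
  calc _ = 3 * ((3 : ℝ≥0∞)⁻¹ * Measure.hausdorffMeasure 1 (curve '' (T ∩ Ico 0 1))) := by
        rw [← mul_assoc, ENNReal.mul_inv_cancel (by norm_num) (by norm_num), one_mul]
    _ ≤ _ := by gcongr

/-- The image of Lebesgue measure on `[0, 1)` on the graph. -/
noncomputable def graphMeasure : Measure (EuclideanSpace ℝ (Fin 2)) :=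
  (volume.restrict (Ico 0 1)).map curve

lemma graphMeasure_apply {A : Set (EuclideanSpace ℝ (Fin 2))} (hA : MeasurableSet A) :
    graphMeasure A = volume (curve ⁻¹' A ∩ Ico 0 1) := by
  rw [graphMeasure, Measure.map_apply measurable_curve hA,
    Measure.restrict_apply (measurable_curve hA)]

lemma inter_graph (A : Set (EuclideanSpace ℝ (Fin 2))) :
    A ∩ graph = curve '' (curve ⁻¹' A ∩ Ico 0 1) := by
  rw [image_preimage_inter, graph]

lemma graphMeasure_le_hausdorffMeasure :
    graphMeasure ≤ (Measure.hausdorffMeasure 1).restrict graph :=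
  Measure.le_iff.2 fun A hA => by
    rw [graphMeasure_apply hA, Measure.restrict_apply hA, inter_graph]
    exact volume_le_hausdorffMeasure _

lemma hausdorffMeasure_restrict_le :
    (Measure.hausdorffMeasure 1).restrict graph ≤ (3 : ℝ≥0∞) • graphMeasure :=
  Measure.le_iff.2 fun A hA => by
    rw [Measure.smul_apply, graphMeasure_apply hA, Measure.restrict_apply hA, inter_graph,
      smul_eq_mul]
    have h := hausdorffMeasure_curve_le ((measurable_curve hA).inter
      (measurableSet_Ico (a := (0 : ℝ)) (b := 1)))
    rwa [inter_assoc, inter_self] at h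

lemma hausdorffMeasure_graph_pos : 0 < Measure.hausdorffMeasure 1 graph :=
  lt_of_lt_of_le (by simp) (volume_le_hausdorffMeasure (Ico 0 1))

lemma hausdorffMeasure_graph_lt_top : Measure.hausdorffMeasure 1 graph < ⊤ := by
  have h := hausdorffMeasure_curve_le (T := Ico 0 1) measurableSet_Ico
  rw [inter_self] at h
  refine h.trans_lt ?_
  simp

/-- Lebesgue-null sets of parameters lift to `𝓗¹`-null sets. No measurability of `P` is assumed, so
the exceptional set is first enlarged to a measurable null set. -/
lemma ae_graph_of_ae {P : EuclideanSpace ℝ (Fin 2) → Prop}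
    (h : ∀ᵐ t ∂(volume.restrict (Ico (0 : ℝ) 1)), P (curve t)) :
    ∀ᵐ x ∂((Measure.hausdorffMeasure 1).restrict graph), P x := by
  rw [ae_restrict_iff' measurableSet_Ico, ae_iff] at h
  rw [ae_restrict_iff' measurableSet_graph, ae_iff]
  set Z := toMeasurable volume {t : ℝ | ¬(t ∈ Ico (0 : ℝ) 1 → P (curve t))} with hZ
  have hZ0 : volume Z = 0 := by rw [hZ, measure_toMeasurable, h]
  have h3 := hausdorffMeasure_curve_le (measurableSet_toMeasurable volume
    {t : ℝ | ¬(t ∈ Ico (0 : ℝ) 1 → P (curve t))})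
  rw [← hZ, hZ0, mul_zero] at h3
  refine measure_mono_null (fun x hx => ?_) (nonpos_iff_eq_zero.1 h3)
  simp only [mem_ofPred_eq, Classical.not_imp] at hx
  obtain ⟨⟨t, ht, rfl⟩, hx⟩ := hx
  refine ⟨t, ⟨subset_toMeasurable _ _ ?_, ht⟩, rfl⟩
  exact fun h => hx (h ht)

/-! ### Lower density zero implies pure unrectifiability -/

section Density

variable {X : Type*} [MetricSpace X] [MeasurableSpace X] [BorelSpace X]

/-- A connected set meeting a ball's centre and leaving the ball has length at least the radius
inside the ball. -/
lemma ofReal_le_hausdorffMeasure_inter_closedBall {Γ : Set X} (hΓ : IsPreconnected Γ) {x y : X}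
    (hx : x ∈ Γ) (hy : y ∈ Γ) {r : ℝ} (hr : r ≤ dist y x) :
    ENNReal.ofReal r ≤ Measure.hausdorffMeasure 1 (Γ ∩ Metric.closedBall x r) := by
  have hL : LipschitzWith 1 fun z : X => dist z x := LipschitzWith.dist_left x
  -- By connectedness the distance to `x` takes every value in `[0, r]` on `Γ`.
  have hsub : Icc 0 r ⊆ (fun z : X => dist z x) '' (Γ ∩ Metric.closedBall x r) := by
    intro s hs
    have himg := (hΓ.image (fun z : X => dist z x) hL.continuous.continuousOn).ordConnected
    obtain ⟨z, hz, hzs⟩ := himg.out ⟨x, hx, dist_self x⟩ ⟨y, hy, rfl⟩ ⟨hs.1, hs.2.trans hr⟩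
    exact ⟨z, ⟨hz, by simpa [Metric.mem_closedBall] using hzs.le.trans hs.2⟩, hzs⟩
  have h := hL.hausdorffMeasure_image_le zero_le_one (Γ ∩ Metric.closedBall x r)
  rw [hausdorffMeasure_real] at h
  calc ENNReal.ofReal r = volume (Icc 0 r) := by simp
    _ ≤ _ := measure_mono hsub
    _ ≤ _ := h
    _ = _ := by simp

/-- A finite measure has upper density zero almost everywhere on its null sets. -/
lemma hausdorffMeasure_eq_zero_of_density [SecondCountableTopology X] {ν : Measure X}
    [IsFiniteMeasure ν] {S : Set X}
    (hS : ν S = 0) {c : ℝ} (hc : 0 < c)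
    (h : ∀ x ∈ S, ∀ ρ > 0, ∃ r, 0 < r ∧ r ≤ ρ ∧
      ENNReal.ofReal (c * r) ≤ ν (Metric.closedBall x r)) :
    Measure.hausdorffMeasure 1 S = 0 := by
  have hstep : ∀ n : ℕ, ∃ u : Set X, ∃ r : X → ℝ, u.Countable ∧
      (∀ x ∈ u, 0 < r x ∧ r x ≤ 1 / ((n : ℝ) + 1)) ∧
      S ⊆ ⋃ x : u, Metric.closedBall (x : X) (5 * r x) ∧
      ∑' x : u, ENNReal.ofReal (c * r x) ≤ ENNReal.ofReal (1 / ((n : ℝ) + 1)) := by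
    intro n
    have hn : 0 < 1 / ((n : ℝ) + 1) := by positivity
    -- Outer regularity gives a neighbourhood of `S` of small `ν`-mass. Disjoint balls inside it
    -- have radii with small sum, and by Vitali their fivefold enlargements cover `S`.
    obtain ⟨U, hSU, hU, hνU⟩ := Set.exists_isOpen_lt_add (μ := ν) S (by simp [hS])
      (ENNReal.ofReal_pos.2 hn).ne'
    rw [hS, zero_add] at hνU
    have hex : ∀ x : X, ∃ r : ℝ, x ∈ S → 0 < r ∧ r ≤ 1 / ((n : ℝ) + 1) ∧
        Metric.closedBall x r ⊆ U ∧ ENNReal.ofReal (c * r) ≤ ν (Metric.closedBall x r) := by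
      intro x
      by_cases hx : x ∈ S
      · obtain ⟨δ, hδ, hδU⟩ := Metric.nhds_basis_closedBall.mem_iff.1 (hU.mem_nhds (hSU hx))
        obtain ⟨r, hr, hrδ, hνr⟩ := h x hx (min δ (1 / ((n : ℝ) + 1))) (lt_min hδ hn)
        exact ⟨r, fun _ => ⟨hr, hrδ.trans (min_le_right _ _),
          (Metric.closedBall_subset_closedBall (hrδ.trans (min_le_left _ _))).trans hδU, hνr⟩⟩
      · exact ⟨0, fun h => absurd h hx⟩
    choose r hr using hex
    obtain ⟨u, huS, hdisj, hcov⟩ := Vitali.exists_disjoint_subfamily_covering_enlargement_closedBall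
      S id r (1 / ((n : ℝ) + 1)) (fun x hx => (hr x hx).2.1) 5 (by norm_num)
    have huc : u.Countable := hdisj.countable_of_nonempty_interior fun x hx =>
      ⟨x, Metric.ball_subset_interior_closedBall (Metric.mem_ball_self (hr x (huS hx)).1)⟩
    refine ⟨u, r, huc, fun x hx => ⟨(hr x (huS hx)).1, (hr x (huS hx)).2.1⟩, fun x hx => ?_, ?_⟩
    · obtain ⟨b, hb, hxb⟩ := hcov x hx
      exact mem_iUnion.2 ⟨⟨b, hb⟩, hxb (Metric.mem_closedBall_self (hr x hx).1.le)⟩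
    · have := huc.to_subtype
      calc ∑' x : u, ENNReal.ofReal (c * r x) ≤ ∑' x : u, ν (Metric.closedBall (x : X) (r x)) :=
            ENNReal.tsum_le_tsum fun x => (hr x (huS x.2)).2.2.2
        _ = ν (⋃ x : u, Metric.closedBall (x : X) (r x)) :=
            (measure_iUnion (hdisj.subtype _ _) fun x => Metric.isClosed_closedBall.measurableSet).symm
        _ ≤ ν U := measure_mono (iUnion_subset fun x => (hr x (huS x.2)).2.2.1)
        _ ≤ _ := hνU.le
  choose u r hu hr hcov hsum using hstep
  have hlim0 : Filter.Tendsto (fun n : ℕ => 1 / ((n : ℝ) + 1)) Filter.atTop (nhds 0) :=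
    tendsto_one_div_add_atTop_nhds_zero_nat
  have hdiam : ∀ n, ∀ x : u n, Metric.ediam (Metric.closedBall (x : X) (5 * r n x))
      ≤ ENNReal.ofReal (10 * r n x) := fun n x => by
    apply Metric.ediam_le
    intro y hy z hz
    rw [edist_dist]
    apply ENNReal.ofReal_le_ofReal
    linarith [dist_triangle_right y z x, Metric.mem_closedBall.1 hy, Metric.mem_closedBall.1 hz]
  have : ∀ n, Countable (u n) := fun n => (hu n).to_subtype
  have key := Measure.hausdorffMeasure_le_liminf_tsum (ι := fun n => ↥(u n)) 1 S
    (l := Filter.atTop) (fun n : ℕ => ENNReal.ofReal (10 * (1 / ((n : ℝ) + 1))))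
    (by simpa using ENNReal.tendsto_ofReal (hlim0.const_mul 10))
    (fun n x => Metric.closedBall (x : X) (5 * r n x))
    (Filter.Eventually.of_forall fun n x => (hdiam n x).trans
      (ENNReal.ofReal_le_ofReal (by linarith [(hr n x x.2).2])))
    (Filter.Eventually.of_forall hcov)
  have hlim : Filter.Tendsto (fun n : ℕ => ENNReal.ofReal (10 / c) *
      ENNReal.ofReal (1 / ((n : ℝ) + 1))) Filter.atTop (nhds 0) := by
    have := ENNReal.Tendsto.const_mul (a := ENNReal.ofReal (10 / c))
      (ENNReal.tendsto_ofReal hlim0) (Or.inr ENNReal.ofReal_ne_top)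
    simpa using this
  refine nonpos_iff_eq_zero.1 (key.trans ((Filter.liminf_le_liminf
    (Filter.Eventually.of_forall fun n => ?_)).trans hlim.liminf_eq.le))
  calc ∑' x : u n, Metric.ediam (Metric.closedBall (x : X) (5 * r n x)) ^ (1 : ℝ)
      ≤ ∑' x : u n, ENNReal.ofReal (10 / c) * ENNReal.ofReal (c * r n x) :=
        ENNReal.tsum_le_tsum fun x => by
          rw [ENNReal.rpow_one, ← ENNReal.ofReal_mul (by positivity)]
          convert hdiam n x using 2
          field_simp
    _ ≤ _ := by
        rw [ENNReal.tsum_mul_left]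
        gcongr
        exact hsum n

/-- A set of lower density zero meets every connected set of finite length in a null set. -/
lemma hausdorffMeasure_inter_eq_zero_of_lower_density [SecondCountableTopology X]
    {E Γ : Set X} (hE : MeasurableSet E)
    (hd : ∀ᵐ x ∂((Measure.hausdorffMeasure 1).restrict E), ∀ c > 0, ∀ ρ > 0, ∃ r, 0 < r ∧ r ≤ ρ ∧
      Measure.hausdorffMeasure 1 (E ∩ Metric.closedBall x r) ≤ ENNReal.ofReal (c * r))
    (hΓ : IsPreconnected Γ) (hfin : Measure.hausdorffMeasure 1 Γ < ⊤) :
    Measure.hausdorffMeasure 1 (E ∩ Γ) = 0 := by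
  rcases Γ.subsingleton_or_nontrivial with hs | hnt
  · have := Measure.nullSingletonClass_hausdorff X zero_lt_one
    exact (hs.anti inter_subset_right).measure_zero _
  rw [ae_restrict_iff' hE, ae_iff] at hd
  set N := {x | ¬(x ∈ E → ∀ c > 0, ∀ ρ > 0, ∃ r, 0 < r ∧ r ≤ ρ ∧
      Measure.hausdorffMeasure 1 (E ∩ Metric.closedBall x r) ≤ ENNReal.ofReal (c * r))} with hN
  set ν := (Measure.hausdorffMeasure 1).restrict (Γ \ E) with hν
  have : IsFiniteMeasure ν := ⟨by
    rw [hν, Measure.restrict_apply_univ]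
    exact (measure_mono sdiff_subset).trans_lt hfin⟩
  have hS : Measure.hausdorffMeasure 1 ((E ∩ Γ) \ N) = 0 := by
    -- On suitable small balls `Γ` has length at least `r` and `E` at most `r / 2`, so `Γ \ E` has
    -- at least `r / 2`. Yet `ν`, which lives on `Γ \ E`, gives `E` no mass.
    refine hausdorffMeasure_eq_zero_of_density (ν := ν) (c := 1 / 2) ?_ (by norm_num) ?_
    · refine measure_mono_null (t := E) (fun x hx => hx.1.1) ?_
      rw [hν, Measure.restrict_apply hE, inter_sdiff_self, measure_empty]
    · rintro x ⟨⟨hxE, hxΓ⟩, hxN⟩ ρ hρ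
      obtain ⟨y, hy, hyx⟩ := hnt.exists_ne x
      obtain ⟨r, hr, hrρ, hrE⟩ := (not_not.1 hxN) hxE (1 / 2) (by norm_num) (min ρ (dist y x))
        (lt_min hρ (dist_pos.2 hyx))
      refine ⟨r, hr, hrρ.trans (min_le_left _ _), ?_⟩
      have h1 := ofReal_le_hausdorffMeasure_inter_closedBall hΓ hxΓ hy
        (hrρ.trans (min_le_right _ _))
      have h2 : Measure.hausdorffMeasure 1 (Γ ∩ Metric.closedBall x r) ≤
          ENNReal.ofReal (1 / 2 * r) + ν (Metric.closedBall x r) := by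
        refine (measure_mono (t := (E ∩ Metric.closedBall x r) ∪
          (Metric.closedBall x r ∩ (Γ \ E))) fun z hz => ?_).trans
          ((measure_union_le _ _).trans ?_)
        · by_cases hzE : z ∈ E
          · exact Or.inl ⟨hzE, hz.2⟩
          · exact Or.inr ⟨hz.2, hz.1, hzE⟩
        · rw [hν, Measure.restrict_apply Metric.isClosed_closedBall.measurableSet]
          gcongr
      have h3 : ENNReal.ofReal r = ENNReal.ofReal (1 / 2 * r) + ENNReal.ofReal (1 / 2 * r) := by
        rw [← ENNReal.ofReal_add (by positivity) (by positivity)]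
        congr 1
        ring
      rw [h3] at h1
      exact (ENNReal.add_le_add_iff_left ENNReal.ofReal_ne_top).1 (h1.trans h2)
  refine measure_mono_null (t := ((E ∩ Γ) \ N) ∪ N) (fun x hx => ?_) (measure_union_null hS hd)
  by_cases h : x ∈ N
  · exact Or.inr h
  · exact Or.inl ⟨hx, h⟩

/-- A set of lower density zero meets every Lipschitz curve in a null set. -/
lemma hausdorffMeasure_inter_range_eq_zero [SecondCountableTopology X] {E : Set X}
    (hE : MeasurableSet E)
    (hd : ∀ᵐ x ∂((Measure.hausdorffMeasure 1).restrict E), ∀ c > 0, ∀ ρ > 0, ∃ r, 0 < r ∧ r ≤ ρ ∧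
      Measure.hausdorffMeasure 1 (E ∩ Metric.closedBall x r) ≤ ENNReal.ofReal (c * r))
    {f : ℝ → X} {K : NNReal} (hf : LipschitzWith K f) :
    Measure.hausdorffMeasure 1 (E ∩ range f) = 0 := by
  have hsub : E ∩ range f ⊆ ⋃ n : ℕ, E ∩ f '' Icc (-n) n := by
    rintro _ ⟨hx, t, rfl⟩
    obtain ⟨n, hn⟩ := exists_nat_ge |t|
    exact mem_iUnion.2 ⟨n, hx, t, abs_le.1 hn, rfl⟩
  refine measure_mono_null hsub (measure_iUnion_null fun n => ?_)
  refine hausdorffMeasure_inter_eq_zero_of_lower_density hE hd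
    (isPreconnected_Icc.image f hf.continuous.continuousOn)
    ?_
  refine (hf.hausdorffMeasure_image_le zero_le_one _).trans_lt ?_
  rw [hausdorffMeasure_real, Real.volume_Icc, ENNReal.rpow_one]
  exact ENNReal.mul_lt_top ENNReal.coe_lt_top ENNReal.ofReal_lt_top

end Density

/-- A set of lower density zero is purely unrectifiable. -/
lemma isPurelyUnrectifiable_of_lower_density {d : ℕ} {E : Set (EuclideanSpace ℝ (Fin d))}
    (hE : MeasurableSet E)
    (hd : ∀ᵐ x ∂((Measure.hausdorffMeasure 1).restrict E), ∀ c > 0, ∀ ρ > 0, ∃ r, 0 < r ∧ r ≤ ρ ∧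
      Measure.hausdorffMeasure 1 (E ∩ Metric.closedBall x r) ≤ ENNReal.ofReal (c * r)) :
    IsPurelyUnrectifiable 1 E := by
  rintro F hFE ⟨⟨f, hf, hnull⟩, -⟩
  rw [Nat.cast_one] at hnull ⊢
  let h : ℝ → EuclideanSpace ℝ (Fin 1) := fun t => !₂[t]
  have hh : LipschitzWith 1 h := LipschitzWith.of_dist_le_mul fun s t => by
    simp [h, EuclideanSpace.dist_eq]
  have hsurj : Function.Surjective h := fun x => ⟨x 0, by
    ext i
    fin_cases i
    rfl⟩
  have hrange : ∀ i, Measure.hausdorffMeasure 1 (E ∩ range (f i)) = 0 := fun i => by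
    obtain ⟨K, hK⟩ := hf i
    rw [← hsurj.range_comp]
    exact hausdorffMeasure_inter_range_eq_zero hE hd (hK.comp hh)
  -- The ranges are measurable because they are σ-compact.
  have hm : MeasurableSet (⋃ i, range (f i))ᶜ := by
    refine (MeasurableSet.iUnion fun i => ?_).compl
    obtain ⟨K, hK⟩ := hf i
    rw [← image_univ]
    obtain ⟨C, hC, hCU⟩ := isSigmaCompact_univ.image hK.continuous
    rw [← hCU]
    exact MeasurableSet.iUnion fun n => (hC n).measurableSet
  rw [Measure.restrict_apply hm] at hnull
  refine measure_mono_null (fun x hx => ?_)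
    (measure_union_null hnull (measure_iUnion_null hrange))
  by_cases hxr : x ∈ ⋃ i, range (f i)
  · obtain ⟨i, hi⟩ := mem_iUnion.1 hxr
    exact Or.inr (mem_iUnion.2 ⟨i, hFE hx, hi⟩)
  · exact Or.inl ⟨hxr, hx⟩

/-! ### Lower density of the graph -/

/-- The lower density of the graph is zero almost everywhere. -/
lemma ae_lower_density_graph :
    ∀ᵐ x ∂((Measure.hausdorffMeasure 1).restrict graph), ∀ c > 0, ∀ ρ > 0, ∃ r, 0 < r ∧ r ≤ ρ ∧
      Measure.hausdorffMeasure 1 (graph ∩ Metric.closedBall x r) ≤ ENNReal.ofReal (c * r) := by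
  refine ae_graph_of_ae ?_
  filter_upwards [ae_frequently_moved] with t ht c hc ρ hρ
  have hfreq : Filter.Tendsto freq Filter.atTop (nhds 0) :=
    Filter.Tendsto.const_div_atTop (Filter.tendsto_atTop_add_const_right _ _
      tendsto_natCast_atTop_atTop) _
  -- The ball of radius `scale k / 2` will have measure at most `3 * freq k * (3 * scale k)`; this
  -- is at most `c * (scale k / 2)` once `freq k ≤ c / 18`.
  obtain ⟨K, hK⟩ := Filter.eventually_atTop.1 ((tendsto_scale.eventually_lt_const hρ).and
    (hfreq.eventually_lt_const (show 0 < c / 18 by positivity)))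
  obtain ⟨k, hkK, hk⟩ := ht K
  obtain ⟨h1, h2⟩ := hK k hkK
  have hl := scale_pos k
  have ha := freq_pos k
  refine ⟨scale k / 2, by positivity, by linarith, ?_⟩
  have hsub : curve ⁻¹' Metric.closedBall (curve t) (scale k / 2) ⊆
      Icc (t - scale k / 2) (t + scale k / 2) ∩ moved k := by
    intro s hs
    rw [mem_preimage, Metric.mem_closedBall, dist_curve] at hs
    have h3 : |s - t| ≤ scale k / 2 := (Real.abs_le_sqrt (by nlinarith)).trans hs
    have h4 : |tail 0 s - tail 0 t| ≤ scale k / 2 := (Real.abs_le_sqrt (by nlinarith)).trans hs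
    rw [abs_le] at h3
    exact ⟨⟨by linarith, by linarith⟩, (bit_eq_iff.1 (bit_eq_of_abs_sub_le h4 k le_rfl)).2 hk⟩
  rw [inter_comm, inter_graph]
  calc _ ≤ 3 * volume (curve ⁻¹' Metric.closedBall (curve t) (scale k / 2)) :=
        hausdorffMeasure_curve_le (measurable_curve Metric.isClosed_closedBall.measurableSet)
    _ ≤ 3 * ENNReal.ofReal (freq k * (2 * (scale k / 2) + 2 * scale k)) := by
        gcongr
        exact (measure_mono hsub).trans (volume_inter_moved_le k t (by positivity))
    _ = ENNReal.ofReal (3 * (freq k * (2 * (scale k / 2) + 2 * scale k))) := by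
        rw [ENNReal.ofReal_mul (p := 3) (by norm_num), ENNReal.ofReal_ofNat]
    _ ≤ _ := by
        apply ENNReal.ofReal_le_ofReal
        nlinarith

lemma isPurelyUnrectifiable_graph : IsPurelyUnrectifiable 1 graph :=
  isPurelyUnrectifiable_of_lower_density measurableSet_graph ae_lower_density_graph

/-! ### Bounding the coefficients by horizontal lines -/

/-- The horizontal line at height `H`. -/
noncomputable def horizontal (H : ℝ) : AffineSubspace ℝ (EuclideanSpace ℝ (Fin 2)) :=
  AffineSubspace.mk' !₂[0, H] (Submodule.span ℝ {!₂[(1 : ℝ), 0]})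

lemma isAffinePlane_horizontal (H : ℝ) : IsAffinePlane 1 (horizontal H) := by
  refine ⟨⟨_, AffineSubspace.self_mem_mk' _ _⟩, ?_⟩
  rw [horizontal, AffineSubspace.direction_mk']
  exact finrank_span_singleton fun h => by
    simpa using congrArg (fun x : EuclideanSpace ℝ (Fin 2) => x 0) h

lemma infEDist_horizontal_le (H s : ℝ) :
    Metric.infEDist (curve s) (horizontal H : Set (EuclideanSpace ℝ (Fin 2)))
      ≤ ENNReal.ofReal |tail 0 s - H| := by
  have hmem : !₂[s, H] ∈ (horizontal H : Set (EuclideanSpace ℝ (Fin 2))) := by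
    rw [SetLike.mem_coe, horizontal, AffineSubspace.mem_mk', Submodule.mem_span_singleton]
    refine ⟨s, ?_⟩
    ext i
    fin_cases i <;> simp
  refine (Metric.infEDist_le_edist_of_mem hmem).trans ?_
  rw [edist_dist, EuclideanSpace.dist_eq, Fin.sum_univ_two]
  simp [Real.dist_eq, Real.sqrt_sq_eq_abs]

/-- The parameters of the points of the graph at distance at most `r` from the point over `t`. -/
def seen (t r : ℝ) : Set ℝ := curve ⁻¹' Metric.closedBall (curve t) r ∩ Ico 0 1

lemma measurableSet_seen (t r : ℝ) : MeasurableSet (seen t r) :=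
  (measurable_curve Metric.isClosed_closedBall.measurableSet).inter measurableSet_Ico

lemma abs_sub_le_of_mem_seen {s t r : ℝ} (h : s ∈ seen t r) :
    |s - t| ≤ r ∧ |tail 0 s - tail 0 t| ≤ r := by
  have hs := h.1
  rw [mem_preimage, Metric.mem_closedBall, dist_curve] at hs
  exact ⟨(Real.abs_le_sqrt (by nlinarith)).trans hs, (Real.abs_le_sqrt (by nlinarith)).trans hs⟩

lemma mem_seen {s t r : ℝ} (hr : 0 ≤ r) (hs : s ∈ Ico (0 : ℝ) 1)
    (h : (s - t) ^ 2 + (tail 0 s - tail 0 t) ^ 2 ≤ r ^ 2) : s ∈ seen t r := by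
  refine ⟨?_, hs⟩
  rw [mem_preimage, Metric.mem_closedBall, dist_curve]
  exact Real.sqrt_le_iff.2 ⟨hr, h⟩

/-- Separates the two contributions to the squared `p`-mean: a sum is at most twice its larger term,
and `6 ^ (2 / p) ≤ 36`. The proportion `θ` acquires the exponent `2 / p` that governs convergence.
-/
lemma mul_add_rpow_sq_le {p θ x y : ℝ} (hp : 1 ≤ p) (hθ : 0 ≤ θ) (hx : 0 ≤ x) (hy : 0 ≤ y) :
    ((3 * (θ * x ^ p + y ^ p)) ^ (1 / p)) ^ 2 ≤ 36 * (θ ^ (2 / p) * x ^ 2 + y ^ 2) := by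
  have hp0 : 0 < p := by linarith
  have hX : 0 ≤ θ * x ^ p := by positivity
  have hY : 0 ≤ y ^ p := by positivity
  have key : ∀ z : ℝ, 0 ≤ z → (z ^ (1 / p)) ^ 2 = z ^ (2 / p) := fun z hz => by
    rw [← Real.rpow_natCast, ← Real.rpow_mul hz]
    congr 1
    push_cast
    ring
  have hpow : ∀ z : ℝ, 0 ≤ z → (z ^ p) ^ (2 / p) = z ^ 2 := fun z hz => by
    rw [← Real.rpow_mul hz, mul_div_cancel₀ _ hp0.ne']
    exact_mod_cast Real.rpow_natCast z 2
  have h6 : (6 : ℝ) ^ (2 / p) ≤ 36 := by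
    calc (6 : ℝ) ^ (2 / p) ≤ 6 ^ (2 : ℝ) := by
          apply Real.rpow_le_rpow_of_exponent_le (by norm_num)
          rw [div_le_iff₀ hp0]
          linarith
      _ = 36 := by norm_num
  have hx2 : (θ * x ^ p) ^ (2 / p) = θ ^ (2 / p) * x ^ 2 := by
    rw [Real.mul_rpow hθ (by positivity), hpow x hx]
  have hmax : ∀ z : ℝ, 0 ≤ z → 3 * (θ * x ^ p + y ^ p) ≤ 6 * z →
      (3 * (θ * x ^ p + y ^ p)) ^ (2 / p) ≤ 36 * z ^ (2 / p) := fun z hz h => by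
    calc _ ≤ (6 * z) ^ (2 / p) := Real.rpow_le_rpow (by positivity) h (by positivity)
      _ = 6 ^ (2 / p) * z ^ (2 / p) := Real.mul_rpow (by norm_num) hz
      _ ≤ _ := by gcongr
  rw [key _ (by positivity)]
  have hθ' : 0 ≤ θ ^ (2 / p) * x ^ 2 := by positivity
  rcases le_total (θ * x ^ p) (y ^ p) with h | h
  · have := hmax _ hY (by linarith)
    rw [hpow y hy] at this
    linarith
  · have := hmax _ hX (by linarith)
    rw [hx2] at this
    nlinarith [sq_nonneg y]

/-- Control of the coefficient through the distance to a horizontal line, which may be worse on a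
part `M` of small proportion. -/
lemma betaTilde_sq_le {p t r H d₀ d₁ θ : ℝ} {M : Set ℝ} (hp : 1 ≤ p) (hr : 0 < r)
    (hd₀ : 0 ≤ d₀) (hd₁ : 0 ≤ d₁) (hθ : 0 ≤ θ) (hM : MeasurableSet M)
    (h₁ : ∀ s ∈ seen t r, |tail 0 s - H| ≤ d₁)
    (h₀ : ∀ s ∈ seen t r, s ∉ M → |tail 0 s - H| ≤ d₀)
    (hvol : volume (seen t r ∩ M) ≤ ENNReal.ofReal θ * volume (seen t r)) :
    (betaTilde 1 p ((Measure.hausdorffMeasure 1).restrict graph) (curve t) r) ^ 2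
      ≤ ENNReal.ofReal (36 * (θ ^ (2 / p) * (d₁ / r) ^ 2 + (d₀ / r) ^ 2)) := by
  have hp0 : 0 < p := by linarith
  set μ := (Measure.hausdorffMeasure 1).restrict graph with hμ
  set A := Metric.closedBall (curve t) r with hA
  have hAm : MeasurableSet A := Metric.isClosed_closedBall.measurableSet
  set f : EuclideanSpace ℝ (Fin 2) → ℝ≥0∞ := fun y => (Metric.infEDist y
    (horizontal H : Set (EuclideanSpace ℝ (Fin 2))) / ENNReal.ofReal r) ^ p with hf
  have hfm : Measurable f := (measurable_infEDist.div_const _).pow_const p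
  have hvA : volume (seen t r) ≤ μ A := by
    rw [seen, ← graphMeasure_apply hAm]
    exact graphMeasure_le_hausdorffMeasure A
  have hpoint : ∀ s, ∀ d : ℝ, 0 ≤ d → |tail 0 s - H| ≤ d →
      f (curve s) ≤ ENNReal.ofReal ((d / r) ^ p) := fun s d hd h => by
    rw [← ENNReal.ofReal_rpow_of_nonneg (by positivity) hp0.le, ENNReal.ofReal_div_of_pos hr]
    exact ENNReal.rpow_le_rpow (ENNReal.div_le_div_right ((infEDist_horizontal_le H s).trans
      (ENNReal.ofReal_le_ofReal h)) _) hp0.le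
  have hint : ∫⁻ s in seen t r, f (curve s) ≤
      ENNReal.ofReal (θ * (d₁ / r) ^ p + (d₀ / r) ^ p) * volume (seen t r) := by
    calc ∫⁻ s in seen t r, f (curve s)
        ≤ ∫⁻ s in seen t r, (M.indicator (fun _ => ENNReal.ofReal ((d₁ / r) ^ p)) s
            + ENNReal.ofReal ((d₀ / r) ^ p)) := by
          refine setLIntegral_mono' (measurableSet_seen t r) fun s hs => ?_
          by_cases hsM : s ∈ M
          · rw [indicator_of_mem hsM]
            exact (hpoint s d₁ hd₁ (h₁ s hs)).trans le_self_add
          · rw [indicator_of_notMem hsM, zero_add]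
            exact hpoint s d₀ hd₀ (h₀ s hs hsM)
      _ = ENNReal.ofReal ((d₁ / r) ^ p) * volume (seen t r ∩ M)
            + ENNReal.ofReal ((d₀ / r) ^ p) * volume (seen t r) := by
          rw [lintegral_add_right _ measurable_const, lintegral_indicator_const hM,
            Measure.restrict_apply hM, setLIntegral_const, inter_comm]
      _ ≤ ENNReal.ofReal ((d₁ / r) ^ p) * (ENNReal.ofReal θ * volume (seen t r))
            + ENNReal.ofReal ((d₀ / r) ^ p) * volume (seen t r) := by gcongr
      _ = _ := by
          rw [ENNReal.ofReal_add (by positivity) (by positivity), ENNReal.ofReal_mul hθ]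
          ring
  -- The factor `3` is the loss in comparing `𝓗¹` on the graph with `graphMeasure`: the numerator is
  -- bounded above by `3` times its `graphMeasure` version, the denominator below by `volume (seen t
  -- r)`.
  have hquot : (∫⁻ y in A, f y ∂μ) / μ A
      ≤ ENNReal.ofReal (3 * (θ * (d₁ / r) ^ p + (d₀ / r) ^ p)) := by
    apply ENNReal.div_le_of_le_mul
    calc ∫⁻ y in A, f y ∂μ ≤ ∫⁻ y in A, f y ∂((3 : ℝ≥0∞) • graphMeasure) :=
          lintegral_mono' (Measure.restrict_mono le_rfl hausdorffMeasure_restrict_le) le_rfl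
      _ = 3 * ∫⁻ s in seen t r, f (curve s) := by
          rw [Measure.restrict_smul, lintegral_smul_measure, graphMeasure,
            setLIntegral_map hAm hfm measurable_curve,
            Measure.restrict_restrict (measurable_curve hAm), smul_eq_mul, seen]
      _ ≤ 3 * (ENNReal.ofReal (θ * (d₁ / r) ^ p + (d₀ / r) ^ p) * μ A) := by
          gcongr
          exact hint.trans (by gcongr)
      _ = _ := by rw [ENNReal.ofReal_mul (p := 3) (by norm_num), ENNReal.ofReal_ofNat, mul_assoc]
  have hbeta : betaTilde 1 p μ (curve t) r ≤ ((∫⁻ y in A, f y ∂μ) / μ A) ^ (1 / p) :=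
    iInf₂_le (horizontal H) (isAffinePlane_horizontal H)
  calc _ ≤ (ENNReal.ofReal (3 * (θ * (d₁ / r) ^ p + (d₀ / r) ^ p)) ^ (1 / p)) ^ 2 := by
        gcongr
        exact hbeta.trans (ENNReal.rpow_le_rpow hquot (by positivity))
    _ = ENNReal.ofReal (((3 * (θ * (d₁ / r) ^ p + (d₀ / r) ^ p)) ^ (1 / p)) ^ 2) := by
        rw [ENNReal.ofReal_rpow_of_nonneg (by positivity) (by positivity),
          ENNReal.ofReal_pow (by positivity)]
    _ ≤ _ := ENNReal.ofReal_le_ofReal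
        (mul_add_rpow_sq_le hp hθ (by positivity) (by positivity))

lemma betaTilde_sq_le_of_abs_le {p t r H d : ℝ} (hp : 1 ≤ p) (hr : 0 < r) (hd : 0 ≤ d)
    (h : ∀ s ∈ seen t r, |tail 0 s - H| ≤ d) :
    (betaTilde 1 p ((Measure.hausdorffMeasure 1).restrict graph) (curve t) r) ^ 2
      ≤ ENNReal.ofReal (36 * (d / r) ^ 2) := by
  have hp0 : 0 < p := by linarith
  have := betaTilde_sq_le (M := ∅) (θ := 0) hp hr hd hd le_rfl MeasurableSet.empty h
    (fun s hs _ => h s hs) (by simp)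
  rwa [Real.zero_rpow (by positivity), zero_mul, zero_add] at this

lemma ofReal_min_le_volume_inter {u v t δ : ℝ} (ht : t ∈ Ico u v) (hδ : 0 ≤ δ) :
    ENNReal.ofReal (min δ (v - u)) ≤ volume (Ico u v ∩ Icc (t - δ) (t + δ)) := by
  have hsub : Ico (max u (t - δ)) (min v (t + δ)) ⊆ Ico u v ∩ Icc (t - δ) (t + δ) := fun s hs =>
    ⟨⟨(le_max_left _ _).trans hs.1, hs.2.trans_le (min_le_left _ _)⟩,
      (le_max_right _ _).trans hs.1, (hs.2.trans_le (min_le_right _ _)).le⟩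
  refine le_trans ?_ (measure_mono hsub)
  rw [Real.volume_Ico]
  apply ENNReal.ofReal_le_ofReal
  obtain ⟨h1, h2⟩ := ht
  rcases max_cases u (t - δ) with ⟨h3, _⟩ | ⟨h3, _⟩ <;>
    rcases min_cases v (t + δ) with ⟨h4, _⟩ | ⟨h4, _⟩ <;> rw [h3, h4] <;>
    rcases min_cases δ (v - u) with ⟨h5, _⟩ | ⟨h5, _⟩ <;> rw [h5] <;> linarith

/-! ### Pointwise bounds at each scale -/

/-- A ball at a scale at which the later displacements are negligible contains a large part of the
graph. -/
lemma ofReal_le_volume_seen {k : ℕ} {t r c : ℝ} (ht : t ∈ Ico (0 : ℝ) 1) (hr : 0 < r)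
    (hk : 2 * scale (k + 1) ≤ r / 2) (hc : c ≤ r / 2)
    (h : c ≤ freq k * scale k ∨ t ∉ moved k ∧ c ≤ scale k / 2) :
    ENNReal.ofReal c ≤ volume (seen t r) := by
  obtain ⟨u, v, htuv, hsub, h1, h2, hbit⟩ := exists_Ico (k := k) ht
  have hcv : c ≤ v - u := by
    rcases h with h | ⟨hm, h⟩
    · exact h.trans h1
    · exact h.trans (h2 hm)
  refine (ENNReal.ofReal_le_ofReal (le_min hc hcv)).trans
    ((ofReal_min_le_volume_inter htuv (by positivity)).trans (measure_mono fun s hs => ?_))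
  refine mem_seen hr.le (hsub hs.1) ?_
  have h3 := abs_tail_zero_sub_le (hbit s hs.1)
  have h4 : |s - t| ≤ r / 2 := abs_le.2 ⟨by linarith [hs.2.1], by linarith [hs.2.2]⟩
  rw [← sq_abs (s - t), ← sq_abs (tail 0 s - tail 0 t)]
  nlinarith [abs_nonneg (s - t), abs_nonneg (tail 0 s - tail 0 t)]

/-- The height of a point seen from `t` at a scale below `scale k`. -/
lemma tail_sub_head_of_mem_seen {k : ℕ} {s t r : ℝ} (hr : r ≤ scale k / 2) (hs : s ∈ seen t r) :
    tail 0 s - head (k + 1) t = tail (k + 1) s := by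
  rw [← head_add_tail (k + 1) s, head_congr (t := t) fun j hj => bit_eq_of_abs_sub_le
    ((abs_sub_le_of_mem_seen hs).2.trans hr) j (by omega)]
  ring

/-- The crude bound: visible points share the displacements up to generation `k`, so their heights
vary only by the later displacements. -/
lemma betaTilde_sq_le_of_le_scale {p t r : ℝ} {k : ℕ} (hp : 1 ≤ p) (hr : 0 < r)
    (hrk : r ≤ scale k / 2) :
    (betaTilde 1 p ((Measure.hausdorffMeasure 1).restrict graph) (curve t) r) ^ 2
      ≤ ENNReal.ofReal (144 * (scale (k + 1) / r) ^ 2) := by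
  have hl := scale_pos (k + 1)
  refine (betaTilde_sq_le_of_abs_le (H := head (k + 1) t) (d := 2 * scale (k + 1)) hp hr
    (by positivity) fun s hs => ?_).trans (ENNReal.ofReal_le_ofReal (le_of_eq (by ring)))
  rw [tail_sub_head_of_mem_seen hrk hs, abs_of_nonneg (tail_nonneg _ _)]
  exact tail_le _ _

/-- Control of the coefficient when the moved part has proportion at most `θ` in the ball. -/
lemma betaTilde_sq_le_of_volume {p t r θ : ℝ} {k : ℕ} (hp : 1 ≤ p) (hr : 0 < r)
    (hrk : r ≤ scale k / 2) (hθ : 0 ≤ θ)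
    (hvol : ENNReal.ofReal (freq (k + 1) * (2 * r + 2 * scale (k + 1)))
      ≤ ENNReal.ofReal θ * volume (seen t r)) :
    (betaTilde 1 p ((Measure.hausdorffMeasure 1).restrict graph) (curve t) r) ^ 2
      ≤ ENNReal.ofReal (144 * (θ ^ (2 / p) + freq (k + 1) ^ 8) * (scale (k + 1) / r) ^ 2) := by
  have hl := scale_pos (k + 1)
  have hl' := scale_pos (k + 2)
  -- Points outside `moved (k + 1)` stay within `2 * scale (k + 2) = 2 * scale (k + 1) * freq (k +
  -- 1) ^ 4` of the line, which produces the term `freq (k + 1) ^ 8`.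
  refine (betaTilde_sq_le (H := head (k + 1) t) (d₁ := 2 * scale (k + 1)) (d₀ := 2 * scale (k + 2))
    hp hr (by positivity) (by positivity) hθ (measurableSet_moved (k + 1)) (fun s hs => ?_)
    (fun s hs hm => ?_) ?_).trans (ENNReal.ofReal_le_ofReal (le_of_eq ?_))
  · rw [tail_sub_head_of_mem_seen hrk hs, abs_of_nonneg (tail_nonneg _ _)]
    exact tail_le _ _
  · rw [tail_sub_head_of_mem_seen hrk hs, abs_of_nonneg (tail_nonneg _ _), tail_eq,
      bit_of_notMem hm, zero_mul, zero_add]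
    exact tail_le _ _
  · refine le_trans (measure_mono (t := Icc (t - r) (t + r) ∩ moved (k + 1))
      fun s hs => ⟨?_, hs.2⟩) ((volume_inter_moved_le (k + 1) t hr.le).trans hvol)
    have := abs_le.1 (abs_sub_le_of_mem_seen hs.1).1
    exact ⟨by linarith, by linarith⟩
  · rw [scale_succ (k + 1)]
    ring

lemma freq_rpow_le {k : ℕ} {q : ℝ} (hq : q ≤ 2) {n : ℕ} (hn : 2 ≤ n) :
    freq k ^ n ≤ freq k ^ q := by
  rw [← Real.rpow_natCast]
  apply Real.rpow_le_rpow_of_exponent_ge (freq_pos k) (by linarith [freq_le k])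
  have : (2 : ℝ) ≤ n := by exact_mod_cast hn
  linarith

lemma two_div_le_two {p : ℝ} (hp : 1 ≤ p) : 2 / p ≤ 2 := by
  rw [div_le_iff₀ (by linarith)]
  linarith

lemma mul_rpow_le_of_le {p c x : ℝ} (hp : 1 ≤ p) (hc : 1 ≤ c) (hx : 0 ≤ x) :
    (c * x) ^ (2 / p) ≤ c ^ 2 * x ^ (2 / p) := by
  rw [Real.mul_rpow (by linarith) hx]
  gcongr
  rw [← Real.rpow_natCast]
  exact Real.rpow_le_rpow_of_exponent_le hc (by simpa using two_div_le_two hp)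

/-- In both cases the ball sees a parameter set of measure at least `r / 8`: a piece adapted to
generation `k` when `r` is large, and the unmoved piece around `t` otherwise. The moved proportion
is then at most a constant times `freq (k + 1)`. -/
lemma betaTilde_sq_le_of_far_or_not_moved {p t r : ℝ} {k : ℕ} (hp : 1 ≤ p)
    (ht : t ∈ Ico (0 : ℝ) 1) (hr : scale (k + 1) / 2 < r) (hrk : r ≤ scale k / 2)
    (hrf : r ≤ freq k * scale k) (h : t ∉ moved (k + 1) ∨ 4 * scale (k + 1) ≤ r) :
    (betaTilde 1 p ((Measure.hausdorffMeasure 1).restrict graph) (curve t) r) ^ 2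
      ≤ ENNReal.ofReal (400000 * freq (k + 1) ^ (2 / p) * (scale (k + 1) / r) ^ 2) := by
  have hl := scale_pos (k + 1)
  have ha := freq_pos (k + 1)
  have hr0 : 0 < r := by linarith
  have hseen : ENNReal.ofReal (r / 8) ≤ volume (seen t r) := by
    by_cases h4 : 4 * scale (k + 1) ≤ r
    · exact ofReal_le_volume_seen (k := k) ht hr0 (by linarith) (by linarith)
        (Or.inl (by linarith))
    · have hm := h.resolve_right h4
      have := scale_succ_le (k + 1)
      exact ofReal_le_volume_seen (k := k + 1) ht hr0 (by linarith) (by linarith)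
        (Or.inr ⟨hm, by linarith⟩)
  refine (betaTilde_sq_le_of_volume (θ := 48 * freq (k + 1)) hp hr0 hrk (by positivity) ?_).trans
    (ENNReal.ofReal_le_ofReal ?_)
  · calc _ ≤ ENNReal.ofReal (48 * freq (k + 1) * (r / 8)) := by
          apply ENNReal.ofReal_le_ofReal
          -- From `scale (k + 1) < 2 * r`, the factor `2 * r + 2 * scale (k + 1)` is at most `6 * r
          -- = 48 * (r / 8)`.
          nlinarith
      _ ≤ _ := by
          rw [ENNReal.ofReal_mul (by positivity)]
          gcongr
  · have h1 := mul_rpow_le_of_le hp (show (1 : ℝ) ≤ 48 by norm_num) ha.le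
    have h2 : freq (k + 1) ^ 8 ≤ freq (k + 1) ^ (2 / p) :=
      freq_rpow_le (two_div_le_two hp) (by norm_num)
    have h3 : (0 : ℝ) ≤ freq (k + 1) ^ (2 / p) := by positivity
    exact mul_le_mul_of_nonneg_right (by linarith) (sq_nonneg _)

/-- Below the excluded window the ball cannot reach the unmoved level, so the line is raised by
`scale (k + 1)`. Above it, a stretch of the unmoved level of length about `√a * l` is visible, where
`a` and `l` are the frequency and scale of generation `k + 1`; the moved proportion is of order
`√a`, hence the exponent `1 / p`. -/
lemma betaTilde_sq_le_of_moved {p t r : ℝ} {k : ℕ} (hp : 1 ≤ p)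
    (ht : t ∈ Ico (0 : ℝ) 1) (hr : scale (k + 1) / 2 < r) (hrk : r ≤ scale k / 2)
    (hm : t ∈ moved (k + 1)) (hr4 : r < 4 * scale (k + 1))
    (h : r ∉ Icc (scale (k + 1) - 2 * scale (k + 2)) ((1 + 4 * freq (k + 1)) * scale (k + 1))) :
    (betaTilde 1 p ((Measure.hausdorffMeasure 1).restrict graph) (curve t) r) ^ 2
      ≤ ENNReal.ofReal (400000 * freq (k + 1) ^ (1 / p) * (scale (k + 1) / r) ^ 2) := by
  have hl := scale_pos (k + 1)
  have hl' := scale_pos (k + 2)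
  have ha := freq_pos (k + 1)
  have ha' := freq_le (k + 1)
  have hr0 : 0 < r := by linarith
  have hp0 : 0 < p := by linarith
  have h8 : freq (k + 1) ^ 8 ≤ freq (k + 1) ^ (1 / p) :=
    freq_rpow_le (by rw [div_le_iff₀ hp0]; linarith) (by norm_num)
  have h0 : (0 : ℝ) ≤ freq (k + 1) ^ (1 / p) := by positivity
  rw [mem_Icc, not_and_or, not_le, not_le] at h
  rcases h with h | h
  · refine (betaTilde_sq_le_of_abs_le (H := head (k + 1) t + scale (k + 1))
      (d := 2 * scale (k + 2)) hp hr0 (by positivity) fun s hs => ?_).trans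
      (ENNReal.ofReal_le_ofReal ?_)
    · have hms : s ∈ moved (k + 1) := by
        by_contra hms
        have h1 := le_abs_tail_zero_sub (k := k + 1) (s := s) (t := t)
          (fun j hj => bit_eq_of_abs_sub_le ((abs_sub_le_of_mem_seen hs).2.trans hrk) j (by omega))
          (by rw [bit_of_mem hm, bit_of_notMem hms]; norm_num)
        have h2 := (abs_sub_le_of_mem_seen hs).2
        linarith
      have h1 := tail_sub_head_of_mem_seen hrk hs
      rw [tail_eq (k + 1), bit_of_mem hms] at h1
      rw [show tail 0 s - (head (k + 1) t + scale (k + 1)) = tail (k + 2) s by linarith,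
        abs_of_nonneg (tail_nonneg _ _)]
      exact tail_le _ _
    · rw [scale_succ (k + 1)]
      calc 36 * (2 * (scale (k + 1) * freq (k + 1) ^ 4) / r) ^ 2
          = 144 * freq (k + 1) ^ 8 * (scale (k + 1) / r) ^ 2 := by ring
        _ ≤ _ := by gcongr; norm_num
  · set a := freq (k + 1) with ha_def
    set l := scale (k + 1) with hl_def
    have hsq : √a ^ 2 = a := Real.sq_sqrt ha.le
    have hsa : 0 < √a := Real.sqrt_pos.2 ha
    have hsa' : √a ≤ 1 / 2 := by
      rw [Real.sqrt_le_left (by norm_num)]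
      linarith
    have hal : a ≤ √a := by nlinarith
    have hseen : ENNReal.ofReal (√a * l) ≤ volume (seen t r) := by
      set n := ⌊t * denom (k + 1)⌋ with hn
      have htn := mem_Ico_iff_floor.2 hn.symm
      have htm := (mem_moved_iff_lt_scale hn.symm).1 hm
      -- This stretch starts where the moved piece ends. Horizontal distance at most `2 * √a * l`
      -- and vertical distance at most `(1 + a) * l` fit into radius `(1 + 4 * a) * l`, since `4 * a
      -- + (1 + a) ^ 2 ≤ (1 + 4 * a) ^ 2`.
      have hsub : Ico ((n + a) * l) ((n + 2 * √a) * l) ⊆ seen t r := by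
        intro s hs
        have hsI : s ∈ Ico (n * scale (k + 1)) ((n + 1) * scale (k + 1)) := by
          refine ⟨le_trans ?_ hs.1, hs.2.trans_le ?_⟩
          · gcongr; linarith
          · gcongr; linarith
        refine mem_seen hr0.le (Ico_subset_unit ht hsI) ?_
        have hfl := mem_Ico_iff_floor.1 hsI
        have hsm : s ∉ moved (k + 1) := fun h =>
          hs.1.not_gt ((mem_moved_iff_lt_scale hfl).1 h)
        have hdiff := tail_zero_sub (k := k + 1) (s := s) (t := t) fun j hj =>
          bit_eq_of_floor_eq hj (by rw [hfl, hn])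
        rw [tail_eq (k + 1) s, tail_eq (k + 1) t, bit_of_mem hm, bit_of_notMem hsm] at hdiff
        have h1 := tail_nonneg (k + 2) s
        have h2 := tail_nonneg (k + 2) t
        have h3 := tail_le (k + 2) s
        have h4 := tail_le (k + 2) t
        have h5 : scale (k + 2) = l * a ^ 4 := scale_succ (k + 1)
        have h6 : a ^ 4 ≤ a / 1000 := by
          have : a ^ 3 ≤ (1 / 10) ^ 3 := pow_le_pow_left₀ ha.le ha' 3
          nlinarith
        have h7 : |tail 0 s - tail 0 t| ≤ l * (1 + a) := by
          rw [hdiff, abs_le]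
          constructor <;> nlinarith
        have h8 : |s - t| ≤ 2 * √a * l := by
          rw [abs_le]
          constructor
          · nlinarith [hs.1]
          · linarith [hs.2, htn.1]
        rw [← sq_abs (s - t), ← sq_abs (tail 0 s - tail 0 t)]
        calc _ ≤ (2 * √a * l) ^ 2 + (l * (1 + a)) ^ 2 := by gcongr
          _ = (4 * a + (1 + a) ^ 2) * l ^ 2 := by linear_combination 4 * l ^ 2 * hsq
          _ ≤ ((1 + 4 * a) * l) ^ 2 := by
              rw [mul_pow]
              gcongr
              nlinarith
          _ ≤ r ^ 2 := by gcongr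
      refine le_trans ?_ (measure_mono hsub)
      rw [Real.volume_Ico]
      apply ENNReal.ofReal_le_ofReal
      nlinarith
    refine (betaTilde_sq_le_of_volume (θ := 10 * √a) hp hr0 hrk (by positivity) ?_).trans
      (ENNReal.ofReal_le_ofReal ?_)
    · rw [← ha_def, ← hl_def]
      calc _ ≤ ENNReal.ofReal (10 * √a * (√a * l)) := by
            apply ENNReal.ofReal_le_ofReal
            calc a * (2 * r + 2 * l) ≤ a * (10 * l) := by gcongr; linarith
              _ = 10 * √a * (√a * l) := by linear_combination -10 * l * hsq
        _ ≤ _ := by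
            rw [ENNReal.ofReal_mul (p := 10 * √a) (by positivity)]
            gcongr
    · have h1 := mul_rpow_le_of_le hp (show (1 : ℝ) ≤ 10 by norm_num) hsa.le
      have h2 : √a ^ (2 / p) = a ^ (1 / p) := by
        rw [Real.sqrt_eq_rpow, ← Real.rpow_mul ha.le]
        congr 1
        field_simp
      rw [h2] at h1
      rw [← ha_def]
      exact mul_le_mul_of_nonneg_right (by linarith) (sq_nonneg _)

/-! ### Integration over the radii -/

lemma lintegral_Ioi_rpow {b x : ℝ} (hb : 0 ≤ b) (hx : 0 < x) :
    ∫⁻ r in Ioi x, ENNReal.ofReal (b * r ^ (-3 : ℝ)) = ENNReal.ofReal (b / (2 * x ^ 2)) := by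
  rw [← ofReal_integral_eq_lintegral_ofReal
    ((integrableOn_Ioi_rpow_of_lt (by norm_num) hx).const_mul b)
    ((ae_restrict_mem measurableSet_Ioi).mono fun r hr => mul_nonneg hb
      (Real.rpow_nonneg (hx.trans hr).le _)), integral_const_mul,
    integral_Ioi_rpow_of_lt (by norm_num) hx]
  congr 1
  rw [show (-3 : ℝ) + 1 = -2 by norm_num, Real.rpow_neg hx.le]
  norm_num
  field_simp

lemma ofReal_mul_div_sq {K l r : ℝ} (hr : 0 < r) :
    ENNReal.ofReal (K * (l / r) ^ 2) / ENNReal.ofReal r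
      = ENNReal.ofReal (K * l ^ 2 * r ^ (-3 : ℝ)) := by
  rw [← ENNReal.ofReal_div_of_pos hr, Real.rpow_neg hr.le]
  congr 1
  norm_num
  field_simp

/-- The contribution of one range of scales to the square function. -/
noncomputable def blockBound (p : ℝ) (k : ℕ) (t : ℝ) : ℝ≥0∞ :=
  ENNReal.ofReal (400000 * freq k ^ (2 / p)) + ENNReal.ofReal (800000 * freq (k + 1) ^ (2 / p)) +
    (moved (k + 1)).indicator
      (fun _ => ENNReal.ofReal (20000000 * freq (k + 1) ^ (1 / p))) t

/-- Collects the regimes: `G` is the crude bound, needed in full only for `r > freq k * scale k` or,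
when the centre is moved, for `r` in the window. Elsewhere `G` comes with a power of `freq (k + 1)`.
-/
lemma betaTilde_sq_div_le {p t r : ℝ} {k : ℕ} (hp : 1 ≤ p)
    (ht : t ∈ Ico (0 : ℝ) 1) (hr : r ∈ Ioc (scale (k + 1) / 2) (scale k / 2))
    {G : ℝ → ℝ≥0∞}
    (hG : G = fun r => ENNReal.ofReal (400000 * scale (k + 1) ^ 2 * r ^ (-3 : ℝ))) :
    (betaTilde 1 p ((Measure.hausdorffMeasure 1).restrict graph) (curve t) r) ^ 2 /
        ENNReal.ofReal r ≤
      (Ioi (freq k * scale k)).indicator G r + ENNReal.ofReal (freq (k + 1) ^ (2 / p)) * G r +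
      (moved (k + 1)).indicator 1 t * (ENNReal.ofReal (freq (k + 1) ^ (1 / p)) * G r +
        (Icc (scale (k + 1) - 2 * scale (k + 2)) ((1 + 4 * freq (k + 1)) * scale (k + 1))).indicator
          G r) := by
  have hl := scale_pos (k + 1)
  have hr0 : 0 < r := by linarith [hr.1]
  have hGr : G r = ENNReal.ofReal (400000 * (scale (k + 1) / r) ^ 2) / ENNReal.ofReal r := by
    rw [hG, ofReal_mul_div_sq hr0]
  have hmul : ∀ x : ℝ, 0 ≤ x → ENNReal.ofReal (400000 * x * (scale (k + 1) / r) ^ 2) /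
      ENNReal.ofReal r = ENNReal.ofReal x * G r := fun x hx => by
    rw [hGr, ← mul_div_assoc, ← ENNReal.ofReal_mul hx]
    congr 2
    ring
  have hA : (betaTilde 1 p ((Measure.hausdorffMeasure 1).restrict graph) (curve t) r) ^ 2 /
      ENNReal.ofReal r ≤ G r := by
    rw [hGr]
    refine ENNReal.div_le_div_right ((betaTilde_sq_le_of_le_scale hp hr0 hr.2).trans
      (ENNReal.ofReal_le_ofReal ?_)) _
    gcongr
    norm_num
  by_cases h1 : freq k * scale k < r
  · rw [indicator_of_mem (show r ∈ Ioi (freq k * scale k) from h1), add_assoc]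
    exact hA.trans le_self_add
  rw [not_lt] at h1
  by_cases h2 : t ∉ moved (k + 1) ∨ 4 * scale (k + 1) ≤ r
  · refine le_trans ?_ (le_self_add.trans' le_add_self)
    rw [← hmul _ (Real.rpow_nonneg (freq_pos _).le _)]
    exact ENNReal.div_le_div_right
      (betaTilde_sq_le_of_far_or_not_moved hp ht hr.1 hr.2 h1 h2) _
  rw [not_or, not_not, not_le] at h2
  refine le_trans ?_ le_add_self
  rw [indicator_of_mem h2.1, Pi.one_apply, one_mul]
  by_cases h3 : r ∈ Icc (scale (k + 1) - 2 * scale (k + 2))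
      ((1 + 4 * freq (k + 1)) * scale (k + 1))
  · rw [indicator_of_mem h3]
    exact hA.trans le_add_self
  · refine le_trans ?_ le_self_add
    rw [← hmul _ (Real.rpow_nonneg (freq_pos _).le _)]
    exact ENNReal.div_le_div_right
      (betaTilde_sq_le_of_moved hp ht hr.1 hr.2 h2.1 h2.2 h3) _

lemma lintegral_block_le {p t : ℝ} (k : ℕ) (hp : 1 ≤ p) (ht : t ∈ Ico (0 : ℝ) 1) :
    ∫⁻ r in Ioc (scale (k + 1) / 2) (scale k / 2),
      (betaTilde 1 p ((Measure.hausdorffMeasure 1).restrict graph) (curve t) r) ^ 2 /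
        ENNReal.ofReal r ≤ blockBound p k t := by
  have hp0 : 0 < p := by linarith
  have hl := scale_pos (k + 1)
  have hL := scale_pos k
  have ha := freq_pos (k + 1)
  have hb := freq_pos k
  set G : ℝ → ℝ≥0∞ := fun r => ENNReal.ofReal (400000 * scale (k + 1) ^ 2 * r ^ (-3 : ℝ)) with hG
  have hGm : Measurable G :=
    ENNReal.measurable_ofReal.comp ((measurable_id.pow_const _).const_mul _)
  set B := Ioc (scale (k + 1) / 2) (scale k / 2) with hB
  set S := Icc (scale (k + 1) - 2 * scale (k + 2)) ((1 + 4 * freq (k + 1)) * scale (k + 1)) with hS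
  have hB2 : ∫⁻ r in B, G r ≤ ENNReal.ofReal 800000 := by
    refine (lintegral_mono_set Ioc_subset_Ioi_self).trans ?_
    rw [lintegral_Ioi_rpow (by positivity) (by positivity)]
    apply ENNReal.ofReal_le_ofReal
    rw [div_le_iff₀ (by positivity)]
    linarith
  -- Here the fourth power in `scale_succ` pays: the ratio of `scale (k + 1)` to `freq k * scale k`
  -- is `freq k ^ 3`, whose square is summable with room to spare.
  have hB1 : ∫⁻ r in B, (Ioi (freq k * scale k)).indicator G r ≤
      ENNReal.ofReal (400000 * freq k ^ (2 / p)) := by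
    refine (lintegral_mono' Measure.restrict_le_self le_rfl).trans ?_
    rw [lintegral_indicator measurableSet_Ioi, lintegral_Ioi_rpow (by positivity) (by positivity)]
    apply ENNReal.ofReal_le_ofReal
    have h6 : freq k ^ 6 ≤ freq k ^ (2 / p) := freq_rpow_le (two_div_le_two hp) (by norm_num)
    rw [scale_succ k]
    calc 400000 * (scale k * freq k ^ 4) ^ 2 / (2 * (freq k * scale k) ^ 2)
        = 200000 * freq k ^ 6 := by field_simp; norm_num
      _ ≤ _ := by nlinarith [pow_pos hb 6]
  -- On the window `G` is of order `1 / scale (k + 1)`, and the window has length of order `freq (k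
  -- + 1) * scale (k + 1)`.
  have hB3 : ∫⁻ r in B, S.indicator G r ≤ ENNReal.ofReal (19200000 * freq (k + 1) ^ (1 / p)) := by
    refine (lintegral_mono' Measure.restrict_le_self le_rfl).trans ?_
    rw [lintegral_indicator measurableSet_Icc]
    have h5 : scale (k + 2) = scale (k + 1) * freq (k + 1) ^ 4 := scale_succ (k + 1)
    have h6 : scale (k + 2) ≤ scale (k + 1) / 10000 := scale_succ_le (k + 1)
    have h7 := scale_pos (k + 2)
    have h8 : freq (k + 1) ^ 4 ≤ freq (k + 1) := by
      have := pow_le_pow_of_le_one ha.le (by linarith [freq_le (k + 1)]) (show 1 ≤ 4 by norm_num)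
      simpa using this
    have h9 : freq (k + 1) ≤ freq (k + 1) ^ (1 / p) := by
      conv_lhs => rw [← Real.rpow_one (freq (k + 1))]
      apply Real.rpow_le_rpow_of_exponent_ge ha (by linarith [freq_le (k + 1)])
      rw [div_le_one hp0]
      exact hp
    have hbound : ∀ r ∈ S, G r ≤ ENNReal.ofReal (3200000 / scale (k + 1)) := fun r hr => by
      have hlr : scale (k + 1) / 2 ≤ r := by linarith [hr.1]
      have hr0 : 0 < r := by linarith
      apply ENNReal.ofReal_le_ofReal
      calc 400000 * scale (k + 1) ^ 2 * r ^ (-3 : ℝ)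
          ≤ 400000 * scale (k + 1) ^ 2 * (scale (k + 1) / 2) ^ (-3 : ℝ) := by
            gcongr 400000 * scale (k + 1) ^ 2 * ?_
            exact Real.rpow_le_rpow_of_nonpos (by positivity) hlr (by norm_num)
        _ = _ := by
            rw [Real.rpow_neg (by positivity)]
            norm_num
            field_simp
            norm_num
    calc ∫⁻ r in S, G r ≤ ∫⁻ _ in S, ENNReal.ofReal (3200000 / scale (k + 1)) :=
          setLIntegral_mono' measurableSet_Icc hbound
      _ = ENNReal.ofReal (3200000 / scale (k + 1) *
            ((1 + 4 * freq (k + 1)) * scale (k + 1) - (scale (k + 1) - 2 * scale (k + 2)))) := by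
          rw [setLIntegral_const, hS, Real.volume_Icc, ENNReal.ofReal_mul (by positivity)]
      _ ≤ _ := by
          apply ENNReal.ofReal_le_ofReal
          rw [h5]
          calc _ = 3200000 * (4 * freq (k + 1) + 2 * freq (k + 1) ^ 4) := by field_simp; ring
            _ ≤ _ := by linarith
  calc _ ≤ ∫⁻ r in B, ((Ioi (freq k * scale k)).indicator G r +
        ENNReal.ofReal (freq (k + 1) ^ (2 / p)) * G r + (moved (k + 1)).indicator 1 t *
        (ENNReal.ofReal (freq (k + 1) ^ (1 / p)) * G r + S.indicator G r)) :=
        setLIntegral_mono' measurableSet_Ioc fun r hr => betaTilde_sq_div_le hp ht hr hG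
    _ = (∫⁻ r in B, (Ioi (freq k * scale k)).indicator G r) +
        ENNReal.ofReal (freq (k + 1) ^ (2 / p)) * (∫⁻ r in B, G r) +
        (moved (k + 1)).indicator 1 t * (ENNReal.ofReal (freq (k + 1) ^ (1 / p)) *
          (∫⁻ r in B, G r) + ∫⁻ r in B, S.indicator G r) := by
        have hSm : Measurable (S.indicator G) := hGm.indicator measurableSet_Icc
        have hIm : Measurable ((Ioi (freq k * scale k)).indicator G) :=
          hGm.indicator measurableSet_Ioi
        rw [lintegral_add_left (f := fun r => (Ioi (freq k * scale k)).indicator G r +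
            ENNReal.ofReal (freq (k + 1) ^ (2 / p)) * G r) (hIm.add (hGm.const_mul _)), lintegral_add_left hIm,
          lintegral_const_mul _ hGm, lintegral_const_mul _
            (f := fun r => ENNReal.ofReal (freq (k + 1) ^ (1 / p)) * G r + S.indicator G r)
            ((hGm.const_mul _).add hSm),
          lintegral_add_left (hGm.const_mul _), lintegral_const_mul _ hGm]
    _ ≤ ENNReal.ofReal (400000 * freq k ^ (2 / p)) +
        ENNReal.ofReal (freq (k + 1) ^ (2 / p)) * ENNReal.ofReal 800000 +
        (moved (k + 1)).indicator 1 t * (ENNReal.ofReal (freq (k + 1) ^ (1 / p)) *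
          ENNReal.ofReal 800000 + ENNReal.ofReal (19200000 * freq (k + 1) ^ (1 / p))) := by
        gcongr
    _ = _ := by
        have e1 : ENNReal.ofReal (freq (k + 1) ^ (2 / p)) * ENNReal.ofReal 800000 =
            ENNReal.ofReal (800000 * freq (k + 1) ^ (2 / p)) := by
          rw [← ENNReal.ofReal_mul (by positivity), mul_comm]
        have e2 : ENNReal.ofReal (freq (k + 1) ^ (1 / p)) * ENNReal.ofReal 800000 +
            ENNReal.ofReal (19200000 * freq (k + 1) ^ (1 / p)) =
            ENNReal.ofReal (20000000 * freq (k + 1) ^ (1 / p)) := by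
          rw [← ENNReal.ofReal_mul (by positivity),
            ← ENNReal.ofReal_add (by positivity) (by positivity)]
          congr 1
          ring
        rw [e1, e2, blockBound]
        by_cases h : t ∈ moved (k + 1)
        · rw [indicator_of_mem h, indicator_of_mem h, Pi.one_apply, one_mul]
        · rw [indicator_of_notMem h, indicator_of_notMem h, zero_mul]

/-! ### Summation over the generations -/

lemma summable_freq_rpow {q : ℝ} (hq : 1 < q) : Summable fun k => freq k ^ q := by
  have h := (summable_nat_add_iff (f := fun n : ℕ => 1 / (n : ℝ) ^ q) 10).2
    (Real.summable_one_div_nat_rpow.2 hq)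
  refine h.congr fun k => ?_
  unfold freq
  rw [Real.div_rpow zero_le_one (by positivity), Real.one_rpow]
  push_cast
  rfl

lemma tsum_freq_rpow_ne_top {q : ℝ} (hq : 1 < q) {c : ℝ} (m : ℕ) :
    ∑' k, ENNReal.ofReal (c * freq (k + m) ^ q) ≠ ⊤ :=
  (((summable_nat_add_iff m).2 (summable_freq_rpow hq)).mul_left c).tsum_ofReal_ne_top

lemma measurable_blockBound (p : ℝ) (k : ℕ) : Measurable (blockBound p k) :=
  Measurable.const_add (measurable_const.indicator (measurableSet_moved _)) _

/-- The sum is integrable in `t`: integrating the term supported on `moved (k + 1)` gains a factor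
`freq (k + 1)`, which raises its exponent to `1 + 1 / p > 1`. The assumption `p < 2` enters through
`2 / p > 1`. -/
lemma ae_tsum_blockBound_lt_top {p : ℝ} (hp : 1 ≤ p) (hp2 : p < 2) :
    ∀ᵐ t ∂(volume.restrict (Ico (0 : ℝ) 1)), ∑' k, blockBound p k t < ⊤ := by
  have hp0 : 0 < p := by linarith
  have h2 : 1 < 2 / p := by rwa [lt_div_iff₀ hp0, one_mul]
  have h1 : 1 < 1 + 1 / p := by linarith [show 0 < 1 / p by positivity]
  refine ae_lt_top (Measurable.tsum (measurable_blockBound p)) ?_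
  rw [lintegral_tsum fun k => (measurable_blockBound p k).aemeasurable]
  have hk : ∀ k, ∫⁻ t in Ico (0 : ℝ) 1, blockBound p k t ≤
      ENNReal.ofReal (400000 * freq (k + 0) ^ (2 / p)) +
      ENNReal.ofReal (800000 * freq (k + 1) ^ (2 / p)) +
      ENNReal.ofReal (60000000 * freq (k + 1) ^ (1 + 1 / p)) := fun k => by
    have ha := freq_pos (k + 1)
    have hl := scale_le_one (k + 1)
    have hvol : volume.restrict (Ico (0 : ℝ) 1) (moved (k + 1)) ≤
        ENNReal.ofReal (3 * freq (k + 1)) := by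
      rw [Measure.restrict_apply (measurableSet_moved _)]
      refine (measure_mono (t := Icc (1 / 2 - 1 / 2) (1 / 2 + 1 / 2) ∩ moved (k + 1)) fun t ht =>
        ⟨⟨by linarith [ht.2.1], by linarith [ht.2.2]⟩, ht.1⟩).trans
        ((volume_inter_moved_le (k + 1) (1 / 2) (by norm_num)).trans
          (ENNReal.ofReal_le_ofReal ?_))
      have := scale_succ_le k
      have := scale_le_one k
      nlinarith
    unfold blockBound
    rw [lintegral_add_left measurable_const, lintegral_const, Measure.restrict_apply_univ,
      Real.volume_Ico, sub_zero, ENNReal.ofReal_one, mul_one,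
      lintegral_indicator_const (measurableSet_moved _), add_zero]
    gcongr
    calc _ ≤ ENNReal.ofReal (20000000 * freq (k + 1) ^ (1 / p)) *
          ENNReal.ofReal (3 * freq (k + 1)) := by gcongr
      _ = _ := by
          rw [← ENNReal.ofReal_mul (by positivity), Real.rpow_add ha, Real.rpow_one]
          congr 1
          ring
  refine ne_top_of_le_ne_top ?_ (ENNReal.tsum_le_tsum hk)
  rw [ENNReal.tsum_add, ENNReal.tsum_add]
  exact ENNReal.add_ne_top.2 ⟨ENNReal.add_ne_top.2
    ⟨tsum_freq_rpow_ne_top h2 0, tsum_freq_rpow_ne_top h2 1⟩, tsum_freq_rpow_ne_top h1 1⟩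

lemma Ioc_subset_iUnion_block :
    Ioc (0 : ℝ) 1 ⊆ Ioi (1 / 2) ∩ Ioc 0 1 ∪ ⋃ k, Ioc (scale (k + 1) / 2) (scale k / 2) := by
  intro r hr
  by_cases h : 1 / 2 < r
  · exact Or.inl ⟨h, hr⟩
  right
  have hex : ∃ k, scale k / 2 < r := by
    obtain ⟨k, hk⟩ := (tendsto_scale.eventually_lt_const hr.1).exists
    exact ⟨k, by linarith [scale_pos k]⟩
  classical
  rcases hk : Nat.find hex with _ | k
  · have := Nat.find_spec hex
    rw [hk, scale_zero] at this
    exact absurd this h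
  · have h1 := Nat.find_spec hex
    rw [hk] at h1
    exact mem_iUnion.2 ⟨k, h1, not_lt.1 (Nat.find_min hex (m := k) (by omega))⟩

lemma lintegral_betaTilde_lt_top {p t : ℝ} (hp : 1 ≤ p) (ht : t ∈ Ico (0 : ℝ) 1)
    (h : ∑' k, blockBound p k t < ⊤) :
    ∫⁻ r in Ioc (0 : ℝ) 1,
      (betaTilde 1 p ((Measure.hausdorffMeasure 1).restrict graph) (curve t) r) ^ 2 /
        ENNReal.ofReal r < ⊤ := by
  refine (lintegral_mono_set Ioc_subset_iUnion_block).trans_lt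
    ((lintegral_union_le _ _ _).trans_lt (ENNReal.add_lt_top.2 ⟨?_, ?_⟩))
  -- The blocks stop at `scale 0 / 2 = 1 / 2`. For larger radii a constant bound on the coefficient
  -- suffices, and `1 ≤ 1 / r` puts it in the form already integrated.
  · refine (setLIntegral_mono' (measurableSet_Ioi.inter measurableSet_Ioc)
      (g := fun r => ENNReal.ofReal (36 * 1 ^ 2 * r ^ (-3 : ℝ))) fun r hr => ?_).trans_lt ?_
    · have hr0 : 0 < r := hr.2.1
      rw [← ofReal_mul_div_sq hr0]
      refine ENNReal.div_le_div_right ((betaTilde_sq_le_of_abs_le (H := tail 0 t) (d := r) hp hr0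
        hr0.le fun s hs => (abs_sub_le_of_mem_seen hs).2).trans (ENNReal.ofReal_le_ofReal ?_)) _
      rw [div_self hr0.ne']
      gcongr
      rw [le_div_iff₀ hr0, one_mul]
      exact hr.2.2
    · refine (lintegral_mono_set inter_subset_left).trans_lt ?_
      rw [lintegral_Ioi_rpow (by norm_num) (by norm_num)]
      exact ENNReal.ofReal_lt_top
  · refine (lintegral_iUnion_le _ _).trans_lt (lt_of_le_of_lt ?_ h)
    exact ENNReal.tsum_le_tsum fun k => lintegral_block_le k hp ht

end MovedGraph

theorem theorem3p1 :
    ∃ E : Set (EuclideanSpace ℝ (Fin 2)),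
      MeasurableSet E ∧
      0 < Measure.hausdorffMeasure (1 : ℝ) E ∧
      Measure.hausdorffMeasure (1 : ℝ) E < ⊤ ∧
      IsPurelyUnrectifiable 1 E ∧
      ∀ p : ℝ, 1 ≤ p → p < 2 →
        ∀ᵐ x ∂((Measure.hausdorffMeasure (1 : ℝ)).restrict E),
          ∫⁻ r in Ioc (0 : ℝ) 1,
            (betaTilde 1 p ((Measure.hausdorffMeasure (1 : ℝ)).restrict E) x r) ^ 2 /
              ENNReal.ofReal r < ⊤ := by
  refine ⟨MovedGraph.graph, MovedGraph.measurableSet_graph, MovedGraph.hausdorffMeasure_graph_pos,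
    MovedGraph.hausdorffMeasure_graph_lt_top, MovedGraph.isPurelyUnrectifiable_graph,
    fun p hp hp2 => MovedGraph.ae_graph_of_ae ?_⟩
  filter_upwards [MovedGraph.ae_tsum_blockBound_lt_top hp hp2, ae_restrict_mem measurableSet_Ico]
    with t ht hmem
  exact MovedGraph.lintegral_betaTilde_lt_top hp hmem ht
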